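/- Conventions. Let $G$ be a group and $k$ a commutative associative unital ring. Algebras are associative $k$-algebras, not necessarily unital. For $k$-submodules $S,T$ of an algebra, $ST$ denotes the $k$-span of all products $xy$ with $x\in S$, $y\in T$. **Product partial actions.** A product partial action $\alpha$ of $G$ on an algebra $A$ consists of two-sided ideals $D_t$ of $A$ and algebra isomorphisms $\alpha_t:D_{t^{-1}}\to D_t$ ($t\in G$) such that for all $s,t\in G$: $\alpha_1$ is the identity map of $A$ (in particular $D_1=A$); $D_t^2=D_t$ and $D_sD_t=D_tD_s$; $\alpha_s(D_{s^{-1}}D_t)=D_sD_{st}$; and $\alpha_s(\alpha_t(x))=\alpha_{st}(x)$ for $x\in D_{t^{-1}}D_{(st)^{-1}}$. The skew group algebra is $A\rtimes_\alpha G=\bigoplus_{t\in G}D_t\delta_t$ with product $(a\delta_r)(b\delta_s)=\alpha_r(\alpha_r^{-1}(a)b)\delta_{rs}$; it is $G$-graded by the components $D_t\delta_t$. **Restriction and globalization.** Let $\beta$ be a (global) action of $G$ on an algebra $B$ by automorphisms and $I$ an idempotent two-sided ideal of $B$ with $I\beta_t(I)=\beta_t(I)I$ for all $t$. The restriction of $\beta$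 to $I$ is the product partial action on $I$ with domains $D_t=I\beta_t(I)$ and isomorphisms $\beta_t|_{D_{t^{-1}}}$. The action $\beta$ is a minimal globalization of a product partial action $\alpha'$ if $\alpha'$ is isomorphic to such a restriction with $B=\sum_{t}\beta_t(I)$. **Smash products.** Let $B=\bigoplus_{t\in G}B_t$ be a $G$-graded algebra. In the algebra of $G\times G$-matrices over $B$ with finitely many nonzero entries, with $be_{r,s}$ the matrix whose only possibly nonzero entry is $b$ at position $(r,s)$, put $B\#G=\bigoplus_{r,s\in G}B_{r^{-1}s}e_{r,s}$. The dual action $\beta^B$ of $G$ on $B\#G$ is given by $\beta^B_t(be_{r,s})=be_{tr,ts}$. The partial smash product is the ideal $I^B=\bigoplus_{r,s\in G}B_{r^{-1}}B_se_{r,s}$ of $B\#G$. If $B_t=B_tB_{t^{-1}}B_t$ for all $t$ (which holds for every skew group algebra of a product partial action), then the restriction $\gamma^B$ of $\beta^B$ to $I^B$ is defined; it is called the canonical partial action of $B$. **Morita equivalence.** A Morita context $(A,A',X,Y,\tau_A,\tau_{A'})$ consists of algebras $A,A'$, bimodules ${}_AX_{A'}$ and ${}_{A'}Y_A$, and bimodule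 maps $\tau_A:X\otimes_{A'}Y\to A$ and $\tau_{A'}:Y\otimes_AX\to A'$ with $\tau_A(x\otimes y)x'=x\tau_{A'}(y\otimes x')$ and $\tau_{A'}(y\otimes x)y'=y\tau_A(x\otimes y')$; its context algebra is the algebra of matrices $\begin{pmatrix}a&x\\y&a'\end{pmatrix}$. It is a Morita equivalence if $AX=X=XA'$, $A'Y=Y=YA$ and $\tau_A,\tau_{A'}$ are surjective. Product partial actions $\alpha$ on $A$ and $\alpha'$ on $A'$, with domains $D_t$ and $D'_t$, are Morita equivalent if there are a Morita equivalence $(A,A',X,Y,\tau_A,\tau_{A'})$ and a product partial action $\theta$ of $G$ on its context algebra, with domains $\bar D_t$, such that for all $t$: $YD_tX=D'_t$ (where $YD_tX:=\tau_{A'}(YD_t\otimes_A X)$); $A\cap\bar D_t=D_t$ and $\theta_t$ restricts to $\alpha_t$ on $D_{t^{-1}}$; and $A'\cap\bar D_t=D'_t$ and $\theta_t$ restricts to $\alpha'_t$ on $D'_{t^{-1}}$. A global action $\beta$ is a Morita enveloping action of $\alpha$ if $\beta$ is a minimal globalization of some product partial action that is Morita equivalent to $\alpha$. **Theorem.** Let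 $\alpha=\{\alpha_t:D_{t^{-1}}\to D_t\}_{t\in G}$ be a product partial action of a group $G$ on an algebra $A$. Then $\alpha$ has a Morita enveloping action. More precisely, let $B=A\rtimes_\alpha G$, let $\gamma^B$ be the canonical partial action of $G$ on the partial smash product $I^B$, and let $\beta^B$ be the dual action of $G$ on $B\#G$. Then $\alpha$ and $\gamma^B$ are Morita equivalent product partial actions, and $\beta^B$ is a Morita enveloping action of $\alpha$. -/

import Mathlib

set_option linter.unusedSectionVars false

namespace PartialActions

/-- The product `S T` of two `k`-submodules of a (not necessarily unital) `k`-algebra: the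
`k`-linear span of all products `x * y` with `x ∈ S` and `y ∈ T`. -/
def mulSub {k A : Type*} [CommRing k] [NonUnitalRing A] [Module k A] [IsScalarTower k A A]
    [SMulCommClass k A A] (S T : Submodule k A) : Submodule k A :=
  Submodule.map₂ (LinearMap.mul k A) S T

infixl:70 " ⬝ₖ " => mulSub

/-- Two-sided ideals of a `k`-algebra. -/
def IsIdeal {k A : Type*} [CommRing k] [NonUnitalRing A] [Module k A] (S : Submodule k A) : Prop :=
  ∀ a x : A, x ∈ S → a * x ∈ S ∧ x * a ∈ S

section Products

variable {k A : Type*} [CommRing k] [NonUnitalRing A] [Module k A] [IsScalarTower k A A]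
  [SMulCommClass k A A]

theorem mul_mem_mulSub {S T : Submodule k A} {x y : A} (hx : x ∈ S) (hy : y ∈ T) :
    x * y ∈ S ⬝ₖ T :=
  Submodule.apply_mem_map₂ (LinearMap.mul k A) hx hy

theorem mulSub_le {S T U : Submodule k A} : S ⬝ₖ T ≤ U ↔ ∀ x ∈ S, ∀ y ∈ T, x * y ∈ U :=
  Submodule.map₂_le

theorem mulSub_mono {S S' T T' : Submodule k A} (h : S ≤ S') (h' : T ≤ T') :
    S ⬝ₖ T ≤ S' ⬝ₖ T' :=
  Submodule.map₂_le_map₂ h h'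


theorem mulSub_assoc (S T U : Submodule k A) : S ⬝ₖ T ⬝ₖ U = S ⬝ₖ (T ⬝ₖ U) := by
  apply le_antisymm
  · rw [mulSub_le]
    intro x hx y hy
    have : S ⬝ₖ T ≤ (S ⬝ₖ (T ⬝ₖ U)).comap (LinearMap.mulRight k y) := by
      rw [mulSub_le]
      intro a ha b hb
      simp only [Submodule.mem_comap, LinearMap.mulRight_apply, mul_assoc]
      exact mul_mem_mulSub ha (mul_mem_mulSub hb hy)
    exact this hx
  · rw [mulSub_le]
    intro x hx y hy
    have : T ⬝ₖ U ≤ (S ⬝ₖ T ⬝ₖ U).comap (LinearMap.mulLeft k x) := by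
      rw [mulSub_le]
      intro a ha b hb
      simp only [Submodule.mem_comap, LinearMap.mulLeft_apply, ← mul_assoc]
      exact mul_mem_mulSub (mul_mem_mulSub hx ha) hb
    exact this hy

theorem map_mulSub {B : Type*} [NonUnitalRing B] [Module k B] [IsScalarTower k B B]
    [SMulCommClass k B B] (f : A →ₗ[k] B) (hf : ∀ x y, f (x * y) = f x * f y)
    (S T : Submodule k A) : (S ⬝ₖ T).map f = S.map f ⬝ₖ T.map f := by
  apply le_antisymm
  · rw [Submodule.map_le_iff_le_comap, mulSub_le]
    intro x hx y hy
    simp only [Submodule.mem_comap, hf]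
    exact mul_mem_mulSub ⟨x, hx, rfl⟩ ⟨y, hy, rfl⟩
  · rw [mulSub_le]
    rintro _ ⟨x, hx, rfl⟩ _ ⟨y, hy, rfl⟩
    exact ⟨x * y, mul_mem_mulSub hx hy, hf x y⟩

theorem mulSub_le_left {S T : Submodule k A} (hS : IsIdeal S) : S ⬝ₖ T ≤ S :=
  mulSub_le.2 fun x hx y _ => (hS y x hx).2

theorem mulSub_le_right {S T : Submodule k A} (hT : IsIdeal T) : S ⬝ₖ T ≤ T :=
  mulSub_le.2 fun x _ y hy => (hT x y hy).1

theorem IsIdeal.mulSub {S T : Submodule k A} (hS : IsIdeal S) (hT : IsIdeal T) :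
    IsIdeal (S ⬝ₖ T) := by
  intro a x hx
  constructor
  · have : S ⬝ₖ T ≤ (S ⬝ₖ T).comap (LinearMap.mulLeft k a) := mulSub_le.2 fun s hs t ht => by
      simp only [Submodule.mem_comap, LinearMap.mulLeft_apply, ← mul_assoc]
      exact mul_mem_mulSub (hS a s hs).1 ht
    exact this hx
  · have : S ⬝ₖ T ≤ (S ⬝ₖ T).comap (LinearMap.mulRight k a) := mulSub_le.2 fun s hs t ht => by
      simp only [Submodule.mem_comap, LinearMap.mulRight_apply, mul_assoc]
      exact mul_mem_mulSub hs (hT a t ht).2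
    exact this hx

end Products

/-- A product partial action of a group `G` on a `k`-algebra `A`: two-sided ideals `D t` and
algebra isomorphisms `act t : D t⁻¹ → D t` such that `act 1` is the identity of `A`,
`D t * D t = D t`, `D s * D t = D t * D s`, `act s (D s⁻¹ * D t) = D s * D (s * t)`, and
`act s (act t x) = act (s * t) x` for `x ∈ D t⁻¹ * D (s * t)⁻¹`. -/
structure ProductPartialAction (k G A : Type*) [CommRing k] [Group G] [NonUnitalRing A]
    [Module k A] [IsScalarTower k A A] [SMulCommClass k A A] where
  /-- the domains -/
  D : G → Submodule k A
  isIdeal : ∀ t, IsIdeal (D t)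
  /-- the isomorphisms -/
  act : ∀ t, D t⁻¹ ≃ₗ[k] D t
  act_mul : ∀ t (x y : D t⁻¹),
    (act t ⟨x * y, (isIdeal t⁻¹ x y y.2).1⟩ : A) = act t x * act t y
  D_one : D 1 = ⊤
  act_one : ∀ x : D 1⁻¹, (act 1 x : A) = x
  D_idem : ∀ t, D t ⬝ₖ D t = D t
  D_comm : ∀ s t, D s ⬝ₖ D t = D t ⬝ₖ D s
  act_image : ∀ s t, {a : A | ∃ x : D s⁻¹, (x : A) ∈ D s⁻¹ ⬝ₖ D t ∧ (act s x : A) = a} =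
    (D s ⬝ₖ D (s * t) : Submodule k A)
  /-- (here `y = act t x` and `z = x`, regarded as elements of `D s⁻¹` and of `D (s * t)⁻¹`) -/
  act_act : ∀ s t (x : D t⁻¹) (y : D s⁻¹) (z : D (s * t)⁻¹),
    (x : A) ∈ D t⁻¹ ⬝ₖ D (s * t)⁻¹ → (y : A) = act t x → (z : A) = x →
      (act s y : A) = act (s * t) z

/-- A (global) action of `G` on a `k`-algebra `B` by algebra automorphisms. -/
structure GlobalAction (k G B : Type*) [CommRing k] [Group G] [NonUnitalRing B]
    [Module k B] where
  /-- the automorphisms -/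
  act : G → B →ₙₐ[k] B
  act_one : ∀ x, act 1 x = x
  act_mul : ∀ s t x, act (s * t) x = act s (act t x)

/-- The image of a submodule under one automorphism of a global action. -/
def GlobalAction.image {k G B : Type*} [CommRing k] [Group G] [NonUnitalRing B] [Module k B]
    (β : GlobalAction k G B) (t : G) (S : Submodule k B) : Submodule k B :=
  S.map (β.act t : B →ₗ[k] B)

section Restriction

variable {k G B : Type*} [CommRing k] [Group G] [NonUnitalRing B]
    [Module k B] [IsScalarTower k B B] [SMulCommClass k B B]

theorem GlobalAction.act_inv_act (β : GlobalAction k G B) (t : G) (x : B) :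
    β.act t⁻¹ (β.act t x) = x := by
  rw [← β.act_mul, inv_mul_cancel, β.act_one]

theorem GlobalAction.act_act_inv (β : GlobalAction k G B) (t : G) (x : B) :
    β.act t (β.act t⁻¹ x) = x := by
  rw [← β.act_mul, mul_inv_cancel, β.act_one]

theorem GlobalAction.image_one (β : GlobalAction k G B) (S : Submodule k B) :
    β.image 1 S = S := by
  ext x
  constructor
  · rintro ⟨y, hy, rfl⟩
    simpa [β.act_one] using hy
  · intro hx
    exact ⟨x, hx, β.act_one x⟩

theorem GlobalAction.image_image (β : GlobalAction k G B) (s t : G) (S : Submodule k B) :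
    β.image s (β.image t S) = β.image (s * t) S := by
  ext x
  constructor
  · rintro ⟨_, ⟨y, hy, rfl⟩, rfl⟩
    exact ⟨y, hy, β.act_mul s t y⟩
  · rintro ⟨y, hy, rfl⟩
    exact ⟨_, ⟨y, hy, rfl⟩, (β.act_mul s t y).symm⟩

theorem GlobalAction.image_mulSub (β : GlobalAction k G B) (t : G) (S T : Submodule k B) :
    β.image t (S ⬝ₖ T) = β.image t S ⬝ₖ β.image t T :=
  map_mulSub _ (fun x y => map_mul (β.act t) x y) S T

/-- The domain `I β_t(I)` of the restriction of `β` to an ideal `I`. -/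
def restrictDomain (β : GlobalAction k G B) (I : NonUnitalSubalgebra k B) (t : G) :
    Submodule k B :=
  I.toSubmodule ⬝ₖ β.image t I.toSubmodule

variable (β : GlobalAction k G B) (I : NonUnitalSubalgebra k B)

theorem image_restrictDomain
    (hcomm : ∀ t, I.toSubmodule ⬝ₖ β.image t I.toSubmodule =
      β.image t I.toSubmodule ⬝ₖ I.toSubmodule) (t : G) :
    β.image t (restrictDomain β I t⁻¹) = restrictDomain β I t := by
  rw [restrictDomain, restrictDomain, β.image_mulSub, β.image_image, mul_inv_cancel, β.image_one,
    hcomm]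

theorem image_comm
    (hcomm : ∀ t, I.toSubmodule ⬝ₖ β.image t I.toSubmodule =
      β.image t I.toSubmodule ⬝ₖ I.toSubmodule) (s t : G) :
    β.image s I.toSubmodule ⬝ₖ β.image t I.toSubmodule =
      β.image t I.toSubmodule ⬝ₖ β.image s I.toSubmodule := by
  have := congrArg (β.image s) (hcomm (s⁻¹ * t))
  simpa only [β.image_mulSub, β.image_image, mul_inv_cancel_left] using this

theorem restrictDomain_mul
    (hidem : I.toSubmodule ⬝ₖ I.toSubmodule = I.toSubmodule)
    (hcomm : ∀ t, I.toSubmodule ⬝ₖ β.image t I.toSubmodule =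
      β.image t I.toSubmodule ⬝ₖ I.toSubmodule) (s t : G) :
    restrictDomain β I s ⬝ₖ restrictDomain β I t =
      I.toSubmodule ⬝ₖ (β.image s I.toSubmodule ⬝ₖ β.image t I.toSubmodule) := by
  rw [restrictDomain, restrictDomain, mulSub_assoc, ← mulSub_assoc (β.image s _), ← hcomm s,
    mulSub_assoc, ← mulSub_assoc, hidem]

theorem restrictDomain_le (hI : IsIdeal I.toSubmodule) (t : G) :
    restrictDomain β I t ≤ I.toSubmodule := mulSub_le_left hI

theorem restrictDomain_isIdeal (hI : IsIdeal I.toSubmodule) (t : G) :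
    IsIdeal (restrictDomain β I t) := by
  refine hI.mulSub ?_
  rintro a _ ⟨x, hx, rfl⟩
  constructor
  · refine ⟨β.act t⁻¹ a * x, (hI _ x hx).1, ?_⟩
    simp [β.act_act_inv]
  · refine ⟨x * β.act t⁻¹ a, (hI _ x hx).2, ?_⟩
    simp [β.act_act_inv]

theorem act_mem_restrictDomain
    (hcomm : ∀ t, I.toSubmodule ⬝ₖ β.image t I.toSubmodule =
      β.image t I.toSubmodule ⬝ₖ I.toSubmodule) (t : G) {x : B}
    (hx : x ∈ restrictDomain β I t⁻¹) : β.act t x ∈ restrictDomain β I t := by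
  rw [← image_restrictDomain β I hcomm]
  exact ⟨x, hx, rfl⟩

/-- The inclusion of a subalgebra as a linear map. -/
def incl : I →ₗ[k] B where
  toFun x := x
  map_add' _ _ := rfl
  map_smul' _ _ := rfl

theorem range_incl : LinearMap.range (incl I) = I.toSubmodule := by
  ext x
  constructor
  · rintro ⟨y, rfl⟩
    exact y.2
  · intro hx
    exact ⟨⟨x, hx⟩, rfl⟩

theorem comap_restrictDomain_mul (hI : IsIdeal I.toSubmodule) (s t : G) :
    (restrictDomain β I s).comap (incl I) ⬝ₖ
      (restrictDomain β I t).comap (incl I) =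
    (restrictDomain β I s ⬝ₖ restrictDomain β I t).comap (incl I) := by
  have hinj : Function.Injective (incl I) := Subtype.val_injective
  apply Submodule.map_injective_of_injective hinj
  rw [map_mulSub (incl I) (fun _ _ => rfl), Submodule.map_comap_eq_of_le,
    Submodule.map_comap_eq_of_le, Submodule.map_comap_eq_of_le]
  · rw [range_incl]
    exact (mulSub_le_left (restrictDomain_isIdeal β I hI s)).trans (restrictDomain_le β I hI s)
  · rw [range_incl]; exact restrictDomain_le β I hI t
  · rw [range_incl]; exact restrictDomain_le β I hI s

/-- The restriction of a global action `β` on `B` to an idempotent ideal `I` of `B` such that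
`I β_t(I) = β_t(I) I` for all `t`: the product partial action on `I` with domains `I β_t(I)` and
isomorphisms given by `β_t`. -/
def GlobalAction.restrict (hI : IsIdeal I.toSubmodule)
    (hidem : I.toSubmodule ⬝ₖ I.toSubmodule = I.toSubmodule)
    (hcomm : ∀ t, I.toSubmodule ⬝ₖ β.image t I.toSubmodule =
      β.image t I.toSubmodule ⬝ₖ I.toSubmodule) : ProductPartialAction k G I where
  D t := (restrictDomain β I t).comap (incl I)
  isIdeal t a x hx := restrictDomain_isIdeal β I hI t a x hx
  act t :=
    { toFun := fun x =>
        ⟨⟨β.act t (x : I), restrictDomain_le β I hI t (act_mem_restrictDomain β I hcomm t x.2)⟩,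
          act_mem_restrictDomain β I hcomm t x.2⟩
      map_add' := fun x y => Subtype.ext (Subtype.ext (map_add (β.act t) _ _))
      map_smul' := fun c x => Subtype.ext (Subtype.ext (map_smul (β.act t) _ _))
      invFun := fun x =>
        have h : β.act t⁻¹ (x : I) ∈ restrictDomain β I t⁻¹ :=
          act_mem_restrictDomain β I hcomm t⁻¹ (by rw [inv_inv]; exact x.2)
        ⟨⟨β.act t⁻¹ (x : I), restrictDomain_le β I hI _ h⟩, h⟩
      left_inv := fun x => Subtype.ext (Subtype.ext (β.act_inv_act t _))
      right_inv := fun x => Subtype.ext (Subtype.ext (β.act_act_inv t _)) }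
  act_mul t x y := Subtype.ext (map_mul (β.act t) _ _)
  D_one := by
    rw [restrictDomain, β.image_one, hidem]
    exact eq_top_iff.2 fun x _ => x.2
  act_one x := Subtype.ext (β.act_one _)
  D_idem t := by
    rw [comap_restrictDomain_mul β I hI, restrictDomain_mul β I hidem hcomm, ← β.image_mulSub,
      hidem, restrictDomain]
  D_comm s t := by
    rw [comap_restrictDomain_mul β I hI, comap_restrictDomain_mul β I hI,
      restrictDomain_mul β I hidem hcomm, restrictDomain_mul β I hidem hcomm,
      image_comm β I hcomm]
  act_image s t := by
    have key : β.image s (restrictDomain β I s⁻¹ ⬝ₖ restrictDomain β I t) =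
        restrictDomain β I s ⬝ₖ restrictDomain β I (s * t) := by
      rw [restrictDomain_mul β I hidem hcomm, restrictDomain_mul β I hidem hcomm,
        β.image_mulSub, β.image_mulSub, β.image_image, β.image_image, mul_inv_cancel,
        β.image_one, ← mulSub_assoc, ← hcomm s, mulSub_assoc]
    rw [comap_restrictDomain_mul β I hI, comap_restrictDomain_mul β I hI, ← key]
    ext a
    constructor
    · rintro ⟨x, hx, rfl⟩
      exact ⟨_, hx, rfl⟩
    · rintro ⟨y, hy, hya⟩
      have hy' : y ∈ restrictDomain β I s⁻¹ :=
        mulSub_le_left (restrictDomain_isIdeal β I hI s⁻¹) hy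
      exact ⟨⟨⟨y, restrictDomain_le β I hI _ hy'⟩, hy'⟩, hy, Subtype.ext hya⟩
  act_act s t x y z _ hy hz := by
    apply Subtype.ext
    have hy' : ((y : I) : B) = β.act t (x : I) := congrArg Subtype.val hy
    have hz' : ((z : I) : B) = (x : I) := congrArg Subtype.val hz
    change β.act s ((y : I) : B) = β.act (s * t) ((z : I) : B)
    rw [hy', hz', β.act_mul]

end Restriction

/-- A `G`-grading `B = ⊕ B_t` of a `k`-algebra `B`. -/
structure Grading (k G B : Type*) [CommRing k] [Group G] [NonUnitalRing B] [Module k B] where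
  /-- the homogeneous components -/
  comp : G → Submodule k B
  indep : iSupIndep comp
  iSup_eq_top : ⨆ t, comp t = ⊤
  mul_mem : ∀ s t x y, x ∈ comp s → y ∈ comp t → x * y ∈ comp (s * t)

/-- A graded algebra is partially-strongly-graded if `B_t = B_t B_{t⁻¹} B_t` for all `t`. -/
def Grading.IsPartiallyStrong {k G B : Type*} [CommRing k] [Group G] [NonUnitalRing B]
    [Module k B] [IsScalarTower k B B] [SMulCommClass k B B] (𝓑 : Grading k G B) : Prop :=
  ∀ t, 𝓑.comp t = 𝓑.comp t ⬝ₖ 𝓑.comp t⁻¹ ⬝ₖ 𝓑.comp t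

/-- `G × G`-matrices over `B` with only finitely many nonzero entries. -/
def FMat (G B : Type*) [Zero B] : Type _ := (G × G) →₀ B

namespace FMat

section Ring

variable {G B : Type*} [NonUnitalRing B]

noncomputable instance : AddCommGroup (FMat G B) := inferInstanceAs (AddCommGroup ((G × G) →₀ B))

noncomputable instance {k : Type*} [CommRing k] [Module k B] : Module k (FMat G B) :=
  inferInstanceAs (Module k ((G × G) →₀ B))

/-- The `(r, s)` entry of a matrix. -/
def entry (f : FMat G B) (r s : G) : B := Finsupp.toFun f (r, s)

/-- The matrix `b e_{r,s}`. -/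
noncomputable def unit (r s : G) (b : B) : FMat G B := Finsupp.single (r, s) b

open Classical in
/-- Matrix multiplication: the bilinear extension of
`(b e_{r,s}) (c e_{u,v}) = [s = u] b c e_{r,v}`. -/
noncomputable instance : Mul (FMat G B) :=
  ⟨fun f g => Finsupp.sum f fun p b => Finsupp.sum g fun q c =>
    if p.2 = q.1 then unit p.1 q.2 (b * c) else 0⟩

@[ext]
theorem ext {f g : FMat G B} (h : ∀ r s, f.entry r s = g.entry r s) : f = g :=
  Finsupp.ext fun p => h p.1 p.2

open Classical in
theorem entry_unit (r s u v : G) (b : B) :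
    (unit r s b).entry u v = if r = u ∧ s = v then b else 0 := by
  change (Finsupp.single (r, s) b) (u, v) = _
  rw [Finsupp.single_apply]
  simp [Prod.ext_iff]

@[simp] theorem entry_zero (r s : G) : (0 : FMat G B).entry r s = 0 := rfl

@[simp] theorem entry_add (f g : FMat G B) (r s : G) :
    (f + g).entry r s = f.entry r s + g.entry r s := rfl

@[simp] theorem entry_smul {k : Type*} [CommRing k] [Module k B] (c : k) (f : FMat G B)
    (r s : G) : (c • f).entry r s = c • f.entry r s := rfl

theorem unit_zero (r s : G) : unit r s (0 : B) = 0 := Finsupp.single_zero _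

theorem unit_add (r s : G) (a b : B) : unit r s (a + b) = unit r s a + unit r s b :=
  Finsupp.single_add _ _ _

theorem induction {p : FMat G B → Prop} (f : FMat G B) (h0 : p 0)
    (hadd : ∀ f g, p f → p g → p (f + g)) (hunit : ∀ r s b, p (unit r s b)) : p f :=
  Finsupp.induction_linear f h0 hadd fun q b => hunit q.1 q.2 b

theorem mul_def' (f g : FMat G B) : f * g = open Classical in
    Finsupp.sum f fun p b => Finsupp.sum g fun q c =>
      if p.2 = q.1 then unit p.1 q.2 (b * c) else 0 := rfl

theorem zero_mul' (g : FMat G B) : 0 * g = 0 := Finsupp.sum_zero_index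

theorem mul_zero' (f : FMat G B) : f * 0 = 0 := by
  rw [mul_def']
  simp only [Finsupp.sum]
  exact Finset.sum_eq_zero fun _ _ => Finset.sum_empty

theorem add_mul' (f g h : FMat G B) : (f + g) * h = f * h + g * h := by
  classical
  refine Finsupp.sum_add_index' (fun p => ?_) (fun p b c => ?_)
  · simp [Finsupp.sum, unit_zero]
  · refine Eq.trans (Finset.sum_congr rfl ?_) Finset.sum_add_distrib
    intro q _
    dsimp only
    split_ifs <;> simp [add_mul, unit_add]

theorem mul_add' (f g h : FMat G B) : f * (g + h) = f * g + f * h := by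
  classical
  rw [mul_def', mul_def', mul_def']
  refine Eq.trans (Finset.sum_congr rfl ?_) Finset.sum_add_distrib
  intro p _
  refine Finsupp.sum_add_index' (fun q => ?_) (fun q b c => ?_)
  · simp [unit_zero]
  · split_ifs <;> simp [mul_add, unit_add]

open Classical in
theorem unit_mul_unit (r s u v : G) (b c : B) :
    unit r s b * unit u v c = if s = u then unit r v (b * c) else 0 := by
  rw [mul_def']
  unfold unit
  rw [Finsupp.sum_single_index, Finsupp.sum_single_index]
  · rw [mul_zero, Finsupp.single_zero]
    exact ite_self _
  · rw [Finsupp.sum]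
    refine Finset.sum_eq_zero fun q _ => ?_
    rw [zero_mul, Finsupp.single_zero]
    exact ite_self _

theorem unit_mul_unit_same (r s v : G) (b c : B) :
    unit r s b * unit s v c = unit r v (b * c) := by
  rw [unit_mul_unit, if_pos rfl]

noncomputable instance : NonUnitalRing (FMat G B) :=
  { (inferInstance : AddCommGroup (FMat G B)), (inferInstance : Mul (FMat G B)) with
    left_distrib := mul_add'
    right_distrib := add_mul'
    zero_mul := zero_mul'
    mul_zero := mul_zero'
    mul_assoc := fun f g h => by
      classical
      refine induction (p := fun f => f * g * h = f * (g * h)) f ?_ (fun f f' hf hf' => ?_)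
        (fun r s a => ?_)
      · simp only [zero_mul']
      · simp only [add_mul', hf, hf']
      refine induction (p := fun g => unit r s a * g * h = unit r s a * (g * h)) g ?_ (fun f f' hf hf' => ?_) (fun u v b => ?_)
      · simp only [zero_mul', mul_zero']
      · simp only [add_mul', mul_add', hf, hf']
      refine induction (p := fun h => unit r s a * unit u v b * h =
        unit r s a * (unit u v b * h)) h ?_ (fun f f' hf hf' => ?_) (fun x y c => ?_)
      · simp only [mul_zero']
      · simp only [mul_add', hf, hf']
      rw [unit_mul_unit, unit_mul_unit]
      split_ifs with h1 h2 h2 <;>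
        simp [unit_mul_unit, mul_assoc, zero_mul', mul_zero', *] }

theorem unit_smul {k : Type*} [CommRing k] [Module k B] (c : k) (r s : G) (b : B) :
    unit r s (c • b) = c • unit r s b := (Finsupp.smul_single c _ b).symm

instance {k : Type*} [CommRing k] [Module k B] [IsScalarTower k B B] :
    IsScalarTower k (FMat G B) (FMat G B) where
  smul_assoc c f g := by
    classical
    simp only [smul_eq_mul]
    refine induction (p := fun f => c • f * g = c • (f * g)) f (by simp) (fun f f' hf hf' => by
      simp only [smul_add, add_mul, hf, hf']) fun r s a => ?_
    refine induction (p := fun g => c • unit r s a * g = c • (unit r s a * g)) g (by simp) (fun f f' hf hf' => by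
      simp only [smul_add, mul_add, hf, hf']) fun u v b => ?_
    rw [← unit_smul, unit_mul_unit, unit_mul_unit]
    split_ifs <;> simp [← unit_smul, smul_mul_assoc]

instance {k : Type*} [CommRing k] [Module k B] [SMulCommClass k B B] :
    SMulCommClass k (FMat G B) (FMat G B) where
  smul_comm c f g := by
    classical
    simp only [smul_eq_mul]
    refine induction (p := fun f => c • (f * g) = f * c • g) f (by simp) (fun f f' hf hf' => by
      simp only [smul_add, add_mul, hf, hf']) fun r s a => ?_
    refine induction (p := fun g => c • (unit r s a * g) = unit r s a * c • g) g (by simp) (fun f f' hf hf' => by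
      simp only [smul_add, mul_add, hf, hf']) fun u v b => ?_
    rw [← unit_smul, unit_mul_unit, unit_mul_unit]
    split_ifs <;> simp [← unit_smul, mul_smul_comm]

theorem eq_sum (f : FMat G B) : f = Finsupp.sum f fun p b => unit p.1 p.2 b :=
  (Finsupp.sum_single f).symm

/-- Every entry of a product is a finite sum of products of entries. -/
theorem entry_mul_mem {k : Type*} [CommRing k] [Module k B] (f g : FMat G B) (r v : G)
    (S : Submodule k B) (h : ∀ s, f.entry r s * g.entry s v ∈ S) : (f * g).entry r v ∈ S := by
  classical
  let ev : FMat G B →+ B :=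
    { toFun := fun f => f.entry r v, map_zero' := rfl, map_add' := fun _ _ => rfl }
  change ev (f * g) ∈ S
  rw [mul_def']
  simp only [Finsupp.sum, map_sum]
  refine S.sum_mem fun p _ => S.sum_mem fun q _ => ?_
  split_ifs with hpq
  · change (unit p.1 q.2 (f.entry p.1 p.2 * g.entry q.1 q.2)).entry r v ∈ S
    rw [entry_unit]
    split_ifs with h1
    · obtain ⟨rfl, rfl⟩ := h1
      rw [← hpq]
      exact h p.2
    · exact S.zero_mem
  · rw [map_zero]; exact S.zero_mem

end Ring

end FMat

section Smash

variable {k G B : Type*} [CommRing k] [Group G] [NonUnitalRing B]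
  [Module k B] [IsScalarTower k B B] [SMulCommClass k B B]

/-- The smash product `B # G = ⊕_{r,s} B_{r⁻¹s} e_{r,s}`. -/
def smash (𝓑 : Grading k G B) : NonUnitalSubalgebra k (FMat G B) where
  carrier := {f | ∀ r s, f.entry r s ∈ 𝓑.comp (r⁻¹ * s)}
  add_mem' hf hg r s := Submodule.add_mem _ (hf r s) (hg r s)
  zero_mem' r s := Submodule.zero_mem _
  smul_mem' c f hf r s := Submodule.smul_mem _ c (hf r s)
  mul_mem' {f g} hf hg r v := FMat.entry_mul_mem f g r v _ fun s => by
    have := 𝓑.mul_mem _ _ _ _ (hf r s) (hg s v)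
    rwa [mul_assoc, mul_inv_cancel_left] at this

theorem Grading.mulSub_le_comp (𝓑 : Grading k G B) (s t : G) :
    𝓑.comp s ⬝ₖ 𝓑.comp t ≤ 𝓑.comp (s * t) :=
  mulSub_le.2 fun x hx y hy => 𝓑.mul_mem s t x y hx hy

/-- The partial smash product `I^B = ⊕_{r,s} B_{r⁻¹} B_s e_{r,s}`, inside `B # G`. -/
def partialSmash (𝓑 : Grading k G B) : NonUnitalSubalgebra k (smash 𝓑) where
  carrier := {f | ∀ r s, (f : FMat G B).entry r s ∈ 𝓑.comp r⁻¹ ⬝ₖ 𝓑.comp s}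
  add_mem' hf hg r s := Submodule.add_mem _ (hf r s) (hg r s)
  zero_mem' r s := Submodule.zero_mem _
  smul_mem' c f hf r s := Submodule.smul_mem _ c (hf r s)
  mul_mem' {f g} hf _ r v := FMat.entry_mul_mem (f : FMat G B) (g : FMat G B) r v _ fun s => by
    have h := mul_mem_mulSub (hf r s) (g.2 s v)
    rw [mulSub_assoc] at h
    refine mulSub_mono le_rfl ?_ h
    simpa using 𝓑.mulSub_le_comp s (s⁻¹ * v)

/-- The shift `b e_{r,s} ↦ b e_{tr,ts}` of finite matrices: `(t · d)(r, s) = d(t⁻¹r, t⁻¹s)`. -/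
noncomputable def FMat.shift (t : G) (f : FMat G B) : FMat G B :=
  Finsupp.equivMapDomain ((Equiv.mulLeft t).prodCongr (Equiv.mulLeft t)) f

theorem FMat.entry_shift (t : G) (f : FMat G B) (r s : G) :
    (f.shift t).entry r s = f.entry (t⁻¹ * r) (t⁻¹ * s) := rfl

theorem FMat.shift_unit (t r s : G) (b : B) : (unit r s b).shift t = unit (t * r) (t * s) b :=
  Finsupp.equivMapDomain_single _ _ _

theorem FMat.shift_zero (t : G) : (0 : FMat G B).shift t = 0 := rfl

theorem FMat.shift_add (t : G) (f g : FMat G B) :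
    (f + g).shift t = f.shift t + g.shift t := FMat.ext fun _ _ => rfl

theorem FMat.shift_mul (t : G) (f g : FMat G B) :
    (f * g).shift t = f.shift t * g.shift t := by
  classical
  refine induction (p := fun f => (f * g).shift t = f.shift t * g.shift t) f
    (by simp [shift_zero]) (fun f f' hf hf' => by
    simp [add_mul, hf, hf', shift_add]) fun r s a => ?_
  refine induction (p := fun g => (unit r s a * g).shift t = (unit r s a).shift t * g.shift t) g
    (by simp [shift_zero]) (fun f f' hf hf' => by
    simp [mul_add, hf, hf', shift_add]) fun u v b => ?_
  rw [shift_unit, shift_unit, unit_mul_unit, unit_mul_unit]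
  simp only [mul_right_inj]
  split_ifs
  · rw [shift_unit]
  · rw [shift_zero]

/-- The dual action `β^B` of `G` on `B # G`. -/
noncomputable def dualAction (𝓑 : Grading k G B) : GlobalAction k G (smash 𝓑) where
  act t :=
    { toFun := fun f => ⟨(f : FMat G B).shift t, fun r s => by
        have h := f.2 (t⁻¹ * r) (t⁻¹ * s)
        rw [FMat.entry_shift]
        convert h using 2
        group⟩
      map_smul' := fun _ _ => Subtype.ext (FMat.ext fun _ _ => rfl)
      map_zero' := rfl
      map_add' := fun f g => Subtype.ext (FMat.shift_add t _ _)
      map_mul' := fun f g => Subtype.ext (FMat.shift_mul t _ _) }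
  act_one f := Subtype.ext (FMat.ext fun r s => by
    change (f : FMat G B).entry (1⁻¹ * r) (1⁻¹ * s) = _
    simp)
  act_mul s t f := Subtype.ext (FMat.ext fun u v => by
    change (f : FMat G B).entry ((s * t)⁻¹ * u) ((s * t)⁻¹ * v) =
      (f : FMat G B).entry (t⁻¹ * (s⁻¹ * u)) (t⁻¹ * (s⁻¹ * v))
    simp [mul_assoc])

end Smash

section Canonical

variable {k G B : Type*} [CommRing k] [Group G] [NonUnitalRing B]
  [Module k B] [IsScalarTower k B B] [SMulCommClass k B B]

/-- The finite matrices whose `(r, s)` entry lies in `F r s` for all `r, s`. -/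
def FMat.entriesIn (F : G → G → Submodule k B) : Submodule k (FMat G B) where
  carrier := {f | ∀ r s, f.entry r s ∈ F r s}
  add_mem' hf hg r s := Submodule.add_mem _ (hf r s) (hg r s)
  zero_mem' _ _ := Submodule.zero_mem _
  smul_mem' c _ hf r s := Submodule.smul_mem _ c (hf r s)

theorem FMat.unit_mem_entriesIn {F : G → G → Submodule k B} {r s : G} {b : B} (hb : b ∈ F r s) :
    unit r s b ∈ entriesIn F := by
  classical
  intro u v
  rw [entry_unit]
  split_ifs with h
  · obtain ⟨rfl, rfl⟩ := h
    exact hb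
  · exact Submodule.zero_mem _

theorem FMat.entriesIn_mul (F F' : G → G → Submodule k B) :
    entriesIn F ⬝ₖ entriesIn F' = entriesIn fun r v => ⨆ s, F r s ⬝ₖ F' s v := by
  apply le_antisymm
  · rw [mulSub_le]
    intro f hf g hg r v
    exact entry_mul_mem f g r v _ fun s =>
      Submodule.mem_iSup_of_mem s (mul_mem_mulSub (hf r s) (hg s v))
  · intro f hf
    have key : ∀ r v, (⨆ s, F r s ⬝ₖ F' s v) ≤ (entriesIn F ⬝ₖ entriesIn F').comap
        ({ toFun := unit r v, map_add' := unit_add r v,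
           map_smul' := fun c b => unit_smul c r v b } : B →ₗ[k] FMat G B) := by
      intro r v
      refine iSup_le fun s => mulSub_le.2 fun b hb c hc => ?_
      change unit r v (b * c) ∈ entriesIn F ⬝ₖ entriesIn F'
      rw [← unit_mul_unit_same r s v]
      exact mul_mem_mulSub (unit_mem_entriesIn hb) (unit_mem_entriesIn hc)
    rw [eq_sum f]
    exact Submodule.sum_mem _ fun p _ => key p.1 p.2 (hf p.1 p.2)

variable (𝓑 : Grading k G B)

theorem map_incl_partialSmash :
    (partialSmash 𝓑).toSubmodule.map (incl (smash 𝓑)) =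
      FMat.entriesIn fun r s => 𝓑.comp r⁻¹ ⬝ₖ 𝓑.comp s := by
  ext f
  constructor
  · rintro ⟨g, hg, rfl⟩
    exact hg
  · intro hf
    refine ⟨⟨f, fun r s => 𝓑.mulSub_le_comp r⁻¹ s (hf r s)⟩, hf, rfl⟩

theorem map_incl_image_partialSmash (t : G) :
    ((dualAction 𝓑).image t (partialSmash 𝓑).toSubmodule).map (incl (smash 𝓑)) =
      FMat.entriesIn fun r s => 𝓑.comp (t⁻¹ * r)⁻¹ ⬝ₖ 𝓑.comp (t⁻¹ * s) := by
  ext f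
  constructor
  · rintro ⟨_, ⟨g, hg, rfl⟩, rfl⟩
    exact fun r s => hg (t⁻¹ * r) (t⁻¹ * s)
  · intro hf
    have hg : ∀ r s, (f.shift t⁻¹).entry r s ∈ 𝓑.comp r⁻¹ ⬝ₖ 𝓑.comp s := by
      intro r s
      rw [FMat.entry_shift]
      have h := hf (t * r) (t * s)
      simpa using h
    refine ⟨_, ⟨⟨f.shift t⁻¹, fun r s => 𝓑.mulSub_le_comp r⁻¹ s (hg r s)⟩, hg, rfl⟩, ?_⟩
    refine FMat.ext fun r s => ?_
    change f.entry _ _ = _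
    simp

theorem incl_injective {A : Type*} [NonUnitalRing A] [Module k A] (I : NonUnitalSubalgebra k A) :
    Function.Injective (incl I) := Subtype.val_injective

namespace Grading

variable {𝓑}

theorem IsPartiallyStrong.one_mul (h : 𝓑.IsPartiallyStrong) (t : G) :
    𝓑.comp 1 ⬝ₖ 𝓑.comp t = 𝓑.comp t := by
  apply le_antisymm
  · simpa using 𝓑.mulSub_le_comp 1 t
  · refine (h t).le.trans (mulSub_mono ?_ le_rfl)
    simpa using 𝓑.mulSub_le_comp t t⁻¹

theorem IsPartiallyStrong.left (h : 𝓑.IsPartiallyStrong) (t s : G) :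
    𝓑.comp t ⬝ₖ 𝓑.comp (t⁻¹ * s) = 𝓑.comp t ⬝ₖ 𝓑.comp t⁻¹ ⬝ₖ 𝓑.comp s := by
  apply le_antisymm
  · refine (mulSub_mono (h t).le le_rfl).trans ?_
    rw [mulSub_assoc _ (𝓑.comp t)]
    refine mulSub_mono le_rfl ?_
    simpa using 𝓑.mulSub_le_comp t (t⁻¹ * s)
  · rw [mulSub_assoc]
    exact mulSub_mono le_rfl (𝓑.mulSub_le_comp _ _)

theorem IsPartiallyStrong.right (h : 𝓑.IsPartiallyStrong) (s t : G) :
    𝓑.comp (s * t) ⬝ₖ 𝓑.comp t⁻¹ = 𝓑.comp s ⬝ₖ 𝓑.comp t ⬝ₖ 𝓑.comp t⁻¹ := by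
  apply le_antisymm
  · refine (mulSub_mono le_rfl (h t⁻¹).le).trans ?_
    rw [inv_inv, mulSub_assoc, ← mulSub_assoc, mulSub_assoc (𝓑.comp s)]
    rw [← mulSub_assoc (𝓑.comp s)]
    have : 𝓑.comp (s * t) ⬝ₖ 𝓑.comp t⁻¹ ≤ 𝓑.comp s := by
      simpa using 𝓑.mulSub_le_comp (s * t) t⁻¹
    rw [mulSub_assoc (𝓑.comp s)]
    exact mulSub_mono this le_rfl
  · exact mulSub_mono (𝓑.mulSub_le_comp _ _) le_rfl

theorem IsPartiallyStrong.smash_mul_image (h : 𝓑.IsPartiallyStrong) (t : G) :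
    ((partialSmash 𝓑).toSubmodule ⬝ₖ
        (dualAction 𝓑).image t (partialSmash 𝓑).toSubmodule).map (incl (smash 𝓑)) =
      FMat.entriesIn fun r s =>
        𝓑.comp r⁻¹ ⬝ₖ (𝓑.comp t ⬝ₖ 𝓑.comp t⁻¹ ⬝ₖ 𝓑.comp s) := by
  rw [map_mulSub (incl (smash 𝓑)) (fun _ _ => rfl), map_incl_partialSmash,
    map_incl_image_partialSmash, FMat.entriesIn_mul]
  congr 1
  funext r v
  rw [← h.left t v]
  apply le_antisymm
  · refine iSup_le fun u => ?_
    rw [mulSub_assoc]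
    refine mulSub_mono le_rfl ?_
    rw [← mulSub_assoc]
    refine mulSub_mono ?_ le_rfl
    simpa using 𝓑.mulSub_le_comp u (t⁻¹ * u)⁻¹
  · refine le_trans ?_ (le_iSup _ 1)
    rw [mul_one, inv_inv, mulSub_assoc, ← mulSub_assoc (𝓑.comp 1), h.one_mul]

theorem IsPartiallyStrong.image_mul_smash (h : 𝓑.IsPartiallyStrong) (t : G) :
    ((dualAction 𝓑).image t (partialSmash 𝓑).toSubmodule ⬝ₖ
        (partialSmash 𝓑).toSubmodule).map (incl (smash 𝓑)) =
      FMat.entriesIn fun r s =>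
        𝓑.comp r⁻¹ ⬝ₖ (𝓑.comp t ⬝ₖ 𝓑.comp t⁻¹ ⬝ₖ 𝓑.comp s) := by
  rw [map_mulSub (incl (smash 𝓑)) (fun _ _ => rfl), map_incl_partialSmash,
    map_incl_image_partialSmash, FMat.entriesIn_mul]
  congr 1
  funext r v
  rw [← mulSub_assoc, ← mulSub_assoc, ← h.right r⁻¹ t, mulSub_assoc]
  have e : (t⁻¹ * r)⁻¹ = r⁻¹ * t := by group
  simp only [e]
  apply le_antisymm
  · refine iSup_le fun u => ?_
    rw [mulSub_assoc]
    refine mulSub_mono le_rfl ?_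
    rw [← mulSub_assoc]
    refine mulSub_mono ?_ le_rfl
    simpa using 𝓑.mulSub_le_comp (t⁻¹ * u) u⁻¹
  · refine le_trans ?_ (le_iSup _ 1)
    rw [mul_one, inv_one, mulSub_assoc, h.one_mul]

theorem IsPartiallyStrong.smash_comm (h : 𝓑.IsPartiallyStrong) (t : G) :
    (partialSmash 𝓑).toSubmodule ⬝ₖ (dualAction 𝓑).image t (partialSmash 𝓑).toSubmodule =
      (dualAction 𝓑).image t (partialSmash 𝓑).toSubmodule ⬝ₖ (partialSmash 𝓑).toSubmodule :=
  Submodule.map_injective_of_injective (incl_injective (smash 𝓑))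
    ((h.smash_mul_image t).trans (h.image_mul_smash t).symm)

theorem IsPartiallyStrong.smash_idem (h : 𝓑.IsPartiallyStrong) :
    (partialSmash 𝓑).toSubmodule ⬝ₖ (partialSmash 𝓑).toSubmodule =
      (partialSmash 𝓑).toSubmodule := by
  refine Submodule.map_injective_of_injective (incl_injective (smash 𝓑)) ?_
  have := h.smash_mul_image 1
  rw [(dualAction 𝓑).image_one] at this
  rw [this, map_incl_partialSmash, inv_one, h.one_mul]
  simp only [h.one_mul]

end Grading

theorem partialSmash_isIdeal : IsIdeal (partialSmash 𝓑).toSubmodule := by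
  intro a x hx
  refine ⟨fun r v => ?_, fun r v => ?_⟩
  · refine FMat.entry_mul_mem (a : FMat G B) (x : FMat G B) r v _ fun s => ?_
    have h := mul_mem_mulSub (a.2 r s) (hx s v)
    rw [← mulSub_assoc] at h
    refine mulSub_mono ?_ le_rfl h
    simpa using 𝓑.mulSub_le_comp (r⁻¹ * s) s⁻¹
  · refine FMat.entry_mul_mem (x : FMat G B) (a : FMat G B) r v _ fun s => ?_
    have h := mul_mem_mulSub (hx r s) (a.2 s v)
    rw [mulSub_assoc] at h
    refine mulSub_mono le_rfl ?_ h
    simpa using 𝓑.mulSub_le_comp s (s⁻¹ * v)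

/-- The canonical partial action `γ^B` of a partially-strongly-graded algebra `B`: the restriction
of the dual action `β^B` on `B # G` to the partial smash product `I^B`. -/
noncomputable def canonicalPartialAction (h : 𝓑.IsPartiallyStrong) :
    ProductPartialAction k G (partialSmash 𝓑) :=
  (dualAction 𝓑).restrict (partialSmash 𝓑) (partialSmash_isIdeal 𝓑) h.smash_idem h.smash_comm

end Canonical

namespace ProductPartialAction

section Skew

variable {k G A : Type*} [CommRing k] [Group G] [NonUnitalRing A]
    [Module k A] [IsScalarTower k A A] [SMulCommClass k A A] (α : ProductPartialAction k G A)

theorem symm_mem {t : G} (a : α.D t) (b : A) : ((α.act t).symm a : A) * b ∈ α.D t⁻¹ :=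
  (α.isIdeal t⁻¹ b _ ((α.act t).symm a).2).2

theorem act_mul' (t : G) (x y z : α.D t⁻¹) (h : (z : A) = x * y) :
    (α.act t z : A) = α.act t x * α.act t y := by
  rw [← α.act_mul]
  exact congrArg (fun w => (α.act t w : A)) (Subtype.ext h)

theorem symm_mul' (t : G) (x y z : α.D t) (h : (z : A) = x * y) :
    ((α.act t).symm z : A) = (α.act t).symm x * (α.act t).symm y := by
  have h1 := α.act_mul t ((α.act t).symm x) ((α.act t).symm y)
  rw [LinearEquiv.apply_symm_apply, LinearEquiv.apply_symm_apply, ← h] at h1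
  rw [← Subtype.ext h1, LinearEquiv.symm_apply_apply]

theorem act_of_eq_one {t : G} (ht : t = 1) (x : α.D t⁻¹) : (α.act t x : A) = x := by
  subst ht
  exact α.act_one x

theorem symm_of_eq_one {t : G} (ht : t = 1) (x : α.D t) : ((α.act t).symm x : A) = x := by
  rw [← α.act_of_eq_one ht, LinearEquiv.apply_symm_apply]

theorem act_add' (t : G) (x y z : α.D t⁻¹) (h : (z : A) = x + y) :
    (α.act t z : A) = α.act t x + α.act t y := by
  have : z = x + y := Subtype.ext h
  rw [this, map_add, Submodule.coe_add]

theorem act_smul' (t : G) (c : k) (x z : α.D t⁻¹) (h : (z : A) = c • (x : A)) :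
    (α.act t z : A) = c • (α.act t x : A) := by
  have : z = c • x := Subtype.ext h
  rw [this, map_smul, Submodule.coe_smul]

/-- The bilinear map `(a, b) ↦ α_r (α_r⁻¹ (a) b)` for `a ∈ D_r` and `b ∈ A`. -/
def twist (r : G) : α.D r →ₗ[k] A →ₗ[k] A :=
  LinearMap.mk₂ k (fun a b => (α.act r ⟨(α.act r).symm a * b, α.symm_mem a b⟩ : A))
    (fun a a' b => α.act_add' r _ _ _ (by simp [add_mul]))
    (fun c a b => α.act_smul' r c _ _ (by simp [smul_mul_assoc]))
    (fun a b b' => α.act_add' r _ _ _ (mul_add _ _ _))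
    (fun c a b => α.act_smul' r c _ _ (mul_smul_comm _ _ _))

theorem twist_apply (r : G) (a : α.D r) (b : A) :
    α.twist r a b = α.act r ⟨(α.act r).symm a * b, α.symm_mem a b⟩ := rfl

theorem coeff_mem (r s : G) (a : α.D r) (b : α.D s) :
    (α.act r ⟨(α.act r).symm a * b, α.symm_mem a b⟩ : A) ∈ α.D r ⬝ₖ α.D (r * s) := by
  have h : (α.act r ⟨(α.act r).symm a * b, α.symm_mem a b⟩ : A) ∈
      (α.D r ⬝ₖ α.D (r * s) : Submodule k A) := by
    rw [← SetLike.mem_coe, ← α.act_image r s]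
    exact ⟨_, mul_mem_mulSub ((α.act r).symm a).2 b.2, rfl⟩
  exact h

/-- The coefficient `α_r (α_r⁻¹ (a) b)` of the product `(a δ_r) (b δ_s)`. -/
def coeff (r s : G) : α.D r →ₗ[k] α.D s →ₗ[k] α.D (r * s) :=
  LinearMap.mk₂ k
    (fun a b => ⟨α.act r ⟨(α.act r).symm a * b, α.symm_mem a b⟩,
      mulSub_le_right (α.isIdeal _) (α.coeff_mem r s a b)⟩)
    (fun a a' b => Subtype.ext (LinearMap.map_add₂ (α.twist r) a a' b))
    (fun c a b => Subtype.ext (LinearMap.map_smul₂ (α.twist r) c a b))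
    (fun a b b' => Subtype.ext (map_add (α.twist r a) (b : A) b'))
    (fun c a b => Subtype.ext (map_smul (α.twist r a) c (b : A)))

theorem coeff_apply (r s : G) (a : α.D r) (b : α.D s) :
    (α.coeff r s a b : A) = α.act r ⟨(α.act r).symm a * b, α.symm_mem a b⟩ := rfl

/-- The skew group algebra `A ⋊_α G = ⊕_t D_t δ_t`. -/
def SkewGroupAlgebra : Type _ := DirectSum G fun t => α.D t

noncomputable instance : AddCommGroup α.SkewGroupAlgebra :=
  inferInstanceAs (AddCommGroup (DirectSum G fun t => α.D t))

noncomputable instance : Module k α.SkewGroupAlgebra :=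
  inferInstanceAs (Module k (DirectSum G fun t => α.D t))

open Classical in
/-- The element `a δ_t` for `a ∈ D_t`. -/
noncomputable def delta (t : G) : α.D t →ₗ[k] α.SkewGroupAlgebra :=
  DirectSum.lof k G (fun t => α.D t) t

open Classical in
/-- The linear map on the skew group algebra with given values on the summands. -/
noncomputable def skewLift {N : Type*} [AddCommGroup N] [Module k N] (f : ∀ t, α.D t →ₗ[k] N) :
    α.SkewGroupAlgebra →ₗ[k] N :=
  DirectSum.toModule k G N f

theorem skewLift_delta {N : Type*} [AddCommGroup N] [Module k N] (f : ∀ t, α.D t →ₗ[k] N) (t : G)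
    (a : α.D t) : α.skewLift f (α.delta t a) = f t a := by
  classical
  exact DirectSum.toModule_lof (M := fun t => α.D t) k t a

/-- The multiplication of the skew group algebra: the bilinear extension of
`(a δ_r) (b δ_s) = α_r (α_r⁻¹ (a) b) δ_{rs}`. -/
noncomputable def skewMul :
    α.SkewGroupAlgebra →ₗ[k] α.SkewGroupAlgebra →ₗ[k] α.SkewGroupAlgebra :=
  α.skewLift fun r => LinearMap.flip <| α.skewLift fun s => LinearMap.flip <|
      (α.coeff r s).compr₂ (α.delta (r * s))

noncomputable instance : Mul α.SkewGroupAlgebra := ⟨fun x y => α.skewMul x y⟩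

theorem skewMul_eq (x y : α.SkewGroupAlgebra) : x * y = α.skewMul x y := rfl

theorem skewMul_delta (r s : G) (a : α.D r) (b : α.D s) :
    α.skewMul (α.delta r a) (α.delta s b) = α.delta (r * s) (α.coeff r s a b) := by
  rw [skewMul, skewLift_delta, LinearMap.flip_apply, skewLift_delta, LinearMap.flip_apply,
    LinearMap.compr₂_apply]

theorem delta_mul_delta (r s : G) (a : α.D r) (b : α.D s) :
    α.delta r a * α.delta s b = α.delta (r * s) (α.coeff r s a b) :=
  α.skewMul_delta r s a b

theorem delta_eq {r s : G} (h : r = s) (a : α.D r) (b : α.D s) (hab : (a : A) = b) :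
    α.delta r a = α.delta s b := by
  subst h
  rw [Subtype.ext hab]

/-- `α_s (α_s⁻¹ (x b) c) = x α_s (α_s⁻¹ (b) c)` for `b ∈ D_s` and `x, c ∈ A`. -/
theorem left_right_comm (s : G) (x c : A) (b : α.D s) :
    α.twist s ⟨x * b, (α.isIdeal s x b b.2).1⟩ c = x * α.twist s b c := by
  let L : α.D s →ₗ[k] A := (α.twist s).flip c ∘ₗ
    ((LinearMap.mulLeft k x).restrict fun b hb => (α.isIdeal s x b hb).1)
  let R : α.D s →ₗ[k] A := LinearMap.mulLeft k x ∘ₗ (α.twist s).flip c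
  change L b = R b
  have hS : α.D s ⬝ₖ α.D s ≤ (LinearMap.eqLocus L R).map (α.D s).subtype := by
    rw [mulSub_le]
    intro b₁ h₁ b₂ h₂
    refine ⟨⟨b₁ * b₂, (α.isIdeal s b₁ b₂ h₂).1⟩, ?_, rfl⟩
    have e : ∀ (u w : α.D s), (w : A) = u * b₂ →
        α.twist s w c = u * α.twist s ⟨b₂, h₂⟩ c := by
      intro u w hw
      rw [twist_apply, twist_apply, α.act_mul' s ((α.act s).symm u)
        ⟨(α.act s).symm ⟨b₂, h₂⟩ * c, α.symm_mem _ c⟩, LinearEquiv.apply_symm_apply]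
      change ((α.act s).symm w : A) * c = (α.act s).symm u * ((α.act s).symm ⟨b₂, h₂⟩ * c)
      rw [α.symm_mul' s u ⟨b₂, h₂⟩ w hw, mul_assoc]
    change α.twist s ⟨x * (b₁ * b₂), _⟩ c = x * α.twist s ⟨b₁ * b₂, _⟩ c
    refine (e ⟨x * b₁, (α.isIdeal s x b₁ h₁).1⟩ _ (mul_assoc x b₁ b₂).symm).trans ?_
    refine Eq.trans ?_ (congrArg (x * ·) (e ⟨b₁, h₁⟩ ⟨b₁ * b₂, _⟩ rfl).symm)
    exact mul_assoc _ _ _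
  obtain ⟨b', hb', h⟩ := hS (show (b : A) ∈ _ by rw [α.D_idem]; exact b.2)
  have : b' = b := Subtype.ext h
  rw [← this]
  exact hb'

theorem coeff_assoc (r s t : G) (a : α.D r) (b : α.D s) (c : α.D t) :
    (α.coeff (r * s) t (α.coeff r s a b) c : A) = α.coeff r (s * t) a (α.coeff s t b c) := by
  have hab : ((α.act r).symm a : A) * b ∈ α.D s := (α.isIdeal s _ _ b.2).1
  -- `a' b = α_s (y)` with `y ∈ D s⁻¹ D (rs)⁻¹`, where `a' = α_r⁻¹ (a)`
  have h1 : ((α.act r).symm a : A) * b ∈ (α.D s ⬝ₖ α.D (s * (s⁻¹ * r⁻¹)) : Submodule k A) := by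
    rw [mul_inv_cancel_left, ← α.D_comm]
    exact mul_mem_mulSub ((α.act r).symm a).2 b.2
  rw [← SetLike.mem_coe, ← α.act_image s (s⁻¹ * r⁻¹)] at h1
  obtain ⟨y, hy, hyab⟩ := h1
  rw [← mul_inv_rev] at hy
  have hy2 : (y : A) ∈ α.D (r * s)⁻¹ := mulSub_le_right (α.isIdeal _) hy
  have hysymm : (α.act s).symm ⟨(α.act r).symm a * b, hab⟩ = y := by
    rw [LinearEquiv.symm_apply_eq]
    exact Subtype.ext hyab.symm
  have h2 : (α.act (r * s)).symm (α.coeff r s a b) = ⟨y, hy2⟩ := by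
    rw [LinearEquiv.symm_apply_eq]
    apply Subtype.ext
    rw [coeff_apply]
    exact α.act_act r s y ⟨(α.act r).symm a * b, α.symm_mem a b⟩ ⟨y, hy2⟩ hy hyab.symm rfl
  have h3 := α.left_right_comm s ((α.act r).symm a) c b
  rw [coeff_apply, coeff_apply]
  symm
  refine α.act_act r s ⟨y * c, (α.isIdeal _ (c : A) (y : A) y.2).2⟩ _ _ ?_ ?_ ?_
  · exact ((α.isIdeal _).mulSub (α.isIdeal _) c y hy).2
  · refine h3.symm.trans ?_
    rw [twist_apply]
    simp only [hysymm]
  · change ((α.act (r * s)).symm _ : A) * c = y * c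
    rw [h2]

theorem skew_induction {p : α.SkewGroupAlgebra → Prop} (x : α.SkewGroupAlgebra) (h0 : p 0)
    (hadd : ∀ x y, p x → p y → p (x + y)) (hd : ∀ t a, p (α.delta t a)) : p x := by
  classical
  exact DirectSum.induction_on (motive := p) x h0 hd hadd

theorem skew_add_mul (x y z : α.SkewGroupAlgebra) : (x + y) * z = x * z + y * z :=
  LinearMap.map_add₂ α.skewMul x y z

theorem skew_mul_add (x y z : α.SkewGroupAlgebra) : x * (y + z) = x * y + x * z :=
  map_add (α.skewMul x) y z

theorem skew_zero_mul (x : α.SkewGroupAlgebra) : 0 * x = 0 := LinearMap.map_zero₂ α.skewMul x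

theorem skew_mul_zero (x : α.SkewGroupAlgebra) : x * 0 = 0 := map_zero (α.skewMul x)

theorem skew_mul_assoc (x y z : α.SkewGroupAlgebra) : x * y * z = x * (y * z) := by
  refine α.skew_induction (p := fun x => x * y * z = x * (y * z)) x ?_ ?_ fun r a => ?_
  · simp only [skew_zero_mul]
  · intro x x' h h'
    simp only [skew_add_mul, h, h']
  refine α.skew_induction (p := fun y => α.delta r a * y * z = α.delta r a * (y * z)) y ?_ ?_
    fun s b => ?_
  · simp only [skew_zero_mul, skew_mul_zero]
  · intro x x' h h'
    simp only [skew_mul_add, skew_add_mul, h, h']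
  refine α.skew_induction (p := fun z => α.delta r a * α.delta s b * z =
    α.delta r a * (α.delta s b * z)) z ?_ ?_ fun t c => ?_
  · simp only [skew_mul_zero]
  · intro x x' h h'
    simp only [skew_mul_add, h, h']
  rw [delta_mul_delta, delta_mul_delta, delta_mul_delta, delta_mul_delta]
  exact α.delta_eq (mul_assoc r s t) _ _ (α.coeff_assoc r s t a b c)

noncomputable instance : NonUnitalRing α.SkewGroupAlgebra :=
  { (inferInstance : AddCommGroup α.SkewGroupAlgebra), (inferInstance : Mul _) with
    left_distrib := α.skew_mul_add
    right_distrib := α.skew_add_mul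
    zero_mul := α.skew_zero_mul
    mul_zero := α.skew_mul_zero
    mul_assoc := α.skew_mul_assoc }

instance : IsScalarTower k α.SkewGroupAlgebra α.SkewGroupAlgebra where
  smul_assoc c x y := LinearMap.map_smul₂ α.skewMul c x y

instance : SMulCommClass k α.SkewGroupAlgebra α.SkewGroupAlgebra where
  smul_comm c x y := (map_smul (α.skewMul x) c y).symm

/-- The natural `G`-grading of the skew group algebra, with components `D_t δ_t`. -/
noncomputable def grading : Grading k G α.SkewGroupAlgebra where
  comp t := LinearMap.range (α.delta t)
  indep := by
    classical
    let π : ∀ t, α.SkewGroupAlgebra →ₗ[k] α.D t := fun t => DirectSum.component k G (fun t => α.D t) t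
    have h1 : ∀ t a, π t (α.delta t a) = a := fun t a => DirectSum.component.lof_self (M := fun t => α.D t) k t a
    have h2 : ∀ s t a, s ≠ t → π t (α.delta s a) = 0 := fun s t a hst =>
      (DirectSum.component.of (M := fun t => α.D t) k t s a).trans (dif_neg hst)
    intro t
    rw [Submodule.disjoint_def]
    rintro _ ⟨a, rfl⟩ hx
    have hle : (⨆ (s : G) (_ : s ≠ t), LinearMap.range (α.delta s)) ≤ LinearMap.ker (π t) := by
      refine iSup_le fun s => iSup_le fun hs => ?_
      rintro _ ⟨b, rfl⟩
      exact h2 s t b hs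
    have h3 : a = 0 := (h1 t a).symm.trans (hle hx)
    rw [h3, map_zero]
  iSup_eq_top := by
    refine eq_top_iff.2 fun x _ => ?_
    refine α.skew_induction x (Submodule.zero_mem _) (fun _ _ => Submodule.add_mem _) ?_
    exact fun t a => Submodule.mem_iSup_of_mem t ⟨a, rfl⟩
  mul_mem := by
    rintro s t _ _ ⟨a, rfl⟩ ⟨b, rfl⟩
    exact ⟨_, (α.delta_mul_delta s t a b).symm⟩

theorem grading_isPartiallyStrong : α.grading.IsPartiallyStrong := by
  intro t
  apply le_antisymm
  · rintro _ ⟨a, rfl⟩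
    have h : α.D t ⬝ₖ α.D t ⬝ₖ α.D t ≤ Submodule.map (α.D t).subtype
        ((α.grading.comp t ⬝ₖ α.grading.comp t⁻¹ ⬝ₖ α.grading.comp t).comap (α.delta t)) := by
      rw [mulSub_assoc, mulSub_le]
      intro a₁ h₁ c hc
      have h' : α.D t ⬝ₖ α.D t ≤ (Submodule.map (α.D t).subtype ((α.grading.comp t ⬝ₖ
          α.grading.comp t⁻¹ ⬝ₖ α.grading.comp t).comap (α.delta t))).comap
          (LinearMap.mulLeft k a₁) := by
        rw [mulSub_le]
        intro a₂ h₂ a₃ h₃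
        have m : a₁ * (a₂ * a₃) ∈ α.D t :=
          (α.isIdeal t a₁ (a₂ * a₃) (α.isIdeal t a₂ a₃ h₃).1).1
        refine ⟨⟨_, m⟩, ?_, rfl⟩
        let w : α.D t⁻¹ := (α.act t).symm ⟨a₂, h₂⟩
        have e1 : (α.coeff t t⁻¹ ⟨a₁, h₁⟩ w : A) = a₁ * a₂ := by
          rw [coeff_apply, α.act_mul' t ((α.act t).symm ⟨a₁, h₁⟩) w _ rfl,
            LinearEquiv.apply_symm_apply, LinearEquiv.apply_symm_apply]
        have e2 : α.delta t ⟨a₁ * (a₂ * a₃), m⟩ =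
            α.delta t ⟨a₁, h₁⟩ * α.delta t⁻¹ w * α.delta t ⟨a₃, h₃⟩ := by
          rw [delta_mul_delta, delta_mul_delta]
          refine α.delta_eq (by group) _ _ ?_
          rw [coeff_apply, α.act_of_eq_one (mul_inv_cancel t)]
          change a₁ * (a₂ * a₃) = ((α.act (t * t⁻¹)).symm _ : A) * a₃
          rw [α.symm_of_eq_one (mul_inv_cancel t), e1, mul_assoc]
        rw [SetLike.mem_coe, Submodule.mem_comap, e2]
        exact mul_mem_mulSub (mul_mem_mulSub ⟨_, rfl⟩ ⟨_, rfl⟩) ⟨_, rfl⟩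
      exact h' hc
    obtain ⟨b, hb, hba⟩ := h (show (a : A) ∈ _ by rw [α.D_idem, α.D_idem]; exact a.2)
    rw [← Subtype.ext hba]
    exact hb
  · refine (mulSub_mono (α.grading.mulSub_le_comp _ _) le_rfl).trans ?_
    simpa using α.grading.mulSub_le_comp (t * t⁻¹) t

end Skew

end ProductPartialAction

/-- A Morita context `(A, A', X, Y, τ_A, τ_{A'})`: an `(A, A')`-bimodule `X`, an `(A', A)`-bimodule
`Y`, and bimodule maps `τ_A : X ⊗_{A'} Y → A` and `τ_{A'} : Y ⊗_A X → A'` that are associative with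
each other. The maps out of the tensor products over `A'` and `A` are given as the balanced
bilinear maps that they correspond to. -/
structure MoritaContext (k A A' X Y : Type*) [CommRing k] [NonUnitalRing A] [Module k A]
    [NonUnitalRing A'] [Module k A'] [AddCommGroup X] [Module k X] [AddCommGroup Y]
    [Module k Y] where
  /-- `(a, x) ↦ a x` -/
  lX : A →ₗ[k] X →ₗ[k] X
  /-- `(x, a') ↦ x a'` -/
  rX : X →ₗ[k] A' →ₗ[k] X
  /-- `(a', y) ↦ a' y` -/
  lY : A' →ₗ[k] Y →ₗ[k] Y
  /-- `(y, a) ↦ y a` -/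
  rY : Y →ₗ[k] A →ₗ[k] Y
  /-- `(x, y) ↦ τ_A (x ⊗ y)` -/
  τA : X →ₗ[k] Y →ₗ[k] A
  /-- `(y, x) ↦ τ_{A'} (y ⊗ x)` -/
  τA' : Y →ₗ[k] X →ₗ[k] A'
  lX_mul : ∀ a b x, lX (a * b) x = lX a (lX b x)
  rX_mul : ∀ x a b, rX x (a * b) = rX (rX x a) b
  lX_rX : ∀ a x a', rX (lX a x) a' = lX a (rX x a')
  lY_mul : ∀ a b y, lY (a * b) y = lY a (lY b y)
  rY_mul : ∀ y a b, rY y (a * b) = rY (rY y a) b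
  lY_rY : ∀ a' y a, rY (lY a' y) a = lY a' (rY y a)
  τA_left : ∀ a x y, τA (lX a x) y = a * τA x y
  τA_right : ∀ x y a, τA x (rY y a) = τA x y * a
  τA_balanced : ∀ x a' y, τA (rX x a') y = τA x (lY a' y)
  τA'_left : ∀ a' y x, τA' (lY a' y) x = a' * τA' y x
  τA'_right : ∀ y x a', τA' y (rX x a') = τA' y x * a'
  τA'_balanced : ∀ y a x, τA' (rY y a) x = τA' y (lX a x)
  assoc_X : ∀ x y x', lX (τA x y) x' = rX x (τA' y x')
  assoc_Y : ∀ y x y', lY (τA' y x) y' = rY y (τA x y')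

namespace MoritaContext

section Context

variable {k A A' X Y : Type*} [CommRing k] [NonUnitalRing A] [Module k A]
    [NonUnitalRing A'] [Module k A'] [AddCommGroup X] [Module k X] [AddCommGroup Y]
    [Module k Y] (M : MoritaContext k A A' X Y)

/-- A Morita context is a Morita equivalence if both bimodules are unital (`A X = X = X A'`,
`A' Y = Y = Y A`) and both trace maps are surjective (`X Y = A`, `Y X = A'`). -/
structure IsEquivalence : Prop where
  lX_unital : Submodule.map₂ M.lX ⊤ ⊤ = ⊤
  rX_unital : Submodule.map₂ M.rX ⊤ ⊤ = ⊤
  lY_unital : Submodule.map₂ M.lY ⊤ ⊤ = ⊤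
  rY_unital : Submodule.map₂ M.rY ⊤ ⊤ = ⊤
  τA_surjective : Submodule.map₂ M.τA ⊤ ⊤ = ⊤
  τA'_surjective : Submodule.map₂ M.τA' ⊤ ⊤ = ⊤

/-- The context algebra of a Morita context: matrices `[a x; y a']`, with entrywise addition and
matrix multiplication. -/
@[nolint unusedArguments]
def ContextAlgebra (_M : MoritaContext k A A' X Y) : Type _ := (A × X) × (Y × A')

instance : AddCommGroup M.ContextAlgebra := inferInstanceAs (AddCommGroup ((A × X) × (Y × A')))

instance : Module k M.ContextAlgebra := inferInstanceAs (Module k ((A × X) × (Y × A')))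

/-- The matrix `[a x; y a']`. -/
def mat (a : A) (x : X) (y : Y) (a' : A') : M.ContextAlgebra := ((a, x), (y, a'))

instance : Mul M.ContextAlgebra :=
  ⟨fun c d => M.mat
    (c.1.1 * d.1.1 + M.τA c.1.2 d.2.1) (M.lX c.1.1 d.1.2 + M.rX c.1.2 d.2.2)
    (M.rY c.2.1 d.1.1 + M.lY c.2.2 d.2.1) (M.τA' c.2.1 d.1.2 + c.2.2 * d.2.2)⟩

theorem mat_mul_mat (a b : A) (x z : X) (y w : Y) (a' b' : A') :
    M.mat a x y a' * M.mat b z w b' =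
      M.mat (a * b + M.τA x w) (M.lX a z + M.rX x b') (M.rY y b + M.lY a' w)
        (M.τA' y z + a' * b') := rfl

theorem mat_add_mat (a b : A) (x z : X) (y w : Y) (a' b' : A') :
    M.mat a x y a' + M.mat b z w b' = M.mat (a + b) (x + z) (y + w) (a' + b') := rfl

theorem smul_mat (c : k) (a : A) (x : X) (y : Y) (a' : A') :
    c • M.mat a x y a' = M.mat (c • a) (c • x) (c • y) (c • a') := rfl

theorem mat_zero : M.mat 0 0 0 0 = 0 := rfl

theorem mat_congr {a b : A} {x z : X} {y w : Y} {a' b' : A'} (h₁ : a = b) (h₂ : x = z)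
    (h₃ : y = w) (h₄ : a' = b') : M.mat a x y a' = M.mat b z w b' := by
  rw [h₁, h₂, h₃, h₄]

theorem exists_mat (c : M.ContextAlgebra) : ∃ a x y a', c = M.mat a x y a' :=
  ⟨c.1.1, c.1.2, c.2.1, c.2.2, rfl⟩

instance : NonUnitalRing M.ContextAlgebra :=
  { (inferInstance : AddCommGroup M.ContextAlgebra), (inferInstance : Mul M.ContextAlgebra) with
    left_distrib := fun c d e => by
      obtain ⟨a₁, x₁, y₁, b₁, rfl⟩ := M.exists_mat c
      obtain ⟨a₂, x₂, y₂, b₂, rfl⟩ := M.exists_mat d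
      obtain ⟨a₃, x₃, y₃, b₃, rfl⟩ := M.exists_mat e
      simp only [mat_mul_mat, mat_add_mat]
      apply mat_congr <;> simp only [mul_add, map_add] <;> abel
    right_distrib := fun c d e => by
      obtain ⟨a₁, x₁, y₁, b₁, rfl⟩ := M.exists_mat c
      obtain ⟨a₂, x₂, y₂, b₂, rfl⟩ := M.exists_mat d
      obtain ⟨a₃, x₃, y₃, b₃, rfl⟩ := M.exists_mat e
      simp only [mat_mul_mat, mat_add_mat]
      apply mat_congr <;> simp only [add_mul, map_add, LinearMap.add_apply] <;> abel
    zero_mul := fun c => by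
      obtain ⟨a₁, x₁, y₁, b₁, rfl⟩ := M.exists_mat c
      rw [← mat_zero, mat_mul_mat]
      apply mat_congr <;> simp
    mul_zero := fun c => by
      obtain ⟨a₁, x₁, y₁, b₁, rfl⟩ := M.exists_mat c
      rw [← mat_zero, mat_mul_mat]
      apply mat_congr <;> simp
    mul_assoc := fun c d e => by
      obtain ⟨a₁, x₁, y₁, b₁, rfl⟩ := M.exists_mat c
      obtain ⟨a₂, x₂, y₂, b₂, rfl⟩ := M.exists_mat d
      obtain ⟨a₃, x₃, y₃, b₃, rfl⟩ := M.exists_mat e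
      simp only [mat_mul_mat]
      apply mat_congr <;>
        simp only [add_mul, mul_add, map_add, LinearMap.add_apply, M.lX_mul, M.rX_mul, M.lX_rX,
          M.lY_mul, M.rY_mul, M.lY_rY, M.τA_left, M.τA_right, M.τA_balanced, M.τA'_left,
          M.τA'_right, M.τA'_balanced, M.assoc_X, M.assoc_Y, mul_assoc] <;> abel }

instance [IsScalarTower k A A] [IsScalarTower k A' A'] :
    IsScalarTower k M.ContextAlgebra M.ContextAlgebra where
  smul_assoc r c d := by
    obtain ⟨a₁, x₁, y₁, b₁, rfl⟩ := M.exists_mat c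
    obtain ⟨a₂, x₂, y₂, b₂, rfl⟩ := M.exists_mat d
    simp only [smul_eq_mul, smul_mat, mat_mul_mat]
    apply mat_congr <;> simp [smul_mul_assoc]

instance [SMulCommClass k A A] [SMulCommClass k A' A'] :
    SMulCommClass k M.ContextAlgebra M.ContextAlgebra where
  smul_comm r c d := by
    obtain ⟨a₁, x₁, y₁, b₁, rfl⟩ := M.exists_mat c
    obtain ⟨a₂, x₂, y₂, b₂, rfl⟩ := M.exists_mat d
    simp only [smul_eq_mul, smul_mat, mat_mul_mat]
    apply mat_congr <;> simp [mul_smul_comm]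

/-- `A` as the upper left corner of the context algebra. -/
def inA : A →ₗ[k] M.ContextAlgebra where
  toFun a := M.mat a 0 0 0
  map_add' a b := by rw [mat_add_mat]; simp
  map_smul' c a := by rw [smul_mat]; simp

/-- `A'` as the lower right corner of the context algebra. -/
def inA' : A' →ₗ[k] M.ContextAlgebra where
  toFun a' := M.mat 0 0 0 a'
  map_add' a b := by rw [mat_add_mat]; simp
  map_smul' c a := by rw [smul_mat]; simp

end Context

end MoritaContext

namespace ProductPartialAction

section Equivalences

universe uk uG uA uA'

variable {k : Type uk} {G : Type uG} {A : Type uA} {A' : Type uA'} [CommRing k] [Group G]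
    [NonUnitalRing A] [Module k A] [IsScalarTower k A A] [SMulCommClass k A A]
    [NonUnitalRing A'] [Module k A'] [IsScalarTower k A' A'] [SMulCommClass k A' A']

/-- `θ|_A = α`, where `A` is regarded as a subalgebra of `C` via `ι`: the domains of `α` are
`A ∩ D_t`, for `D_t` the domains of `θ`, and `α_t` is the restriction of `θ_t`. -/
def RestrictsTo {C : Type*} [NonUnitalRing C] [Module k C] [IsScalarTower k C C]
    [SMulCommClass k C C] (θ : ProductPartialAction k G C) (ι : A →ₗ[k] C)
    (α : ProductPartialAction k G A) : Prop :=
  (∀ t, (θ.D t).comap ι = α.D t) ∧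
    ∀ t (a : α.D t⁻¹) (c : θ.D t⁻¹), (c : C) = ι a → (θ.act t c : C) = ι (α.act t a)

/-- Morita equivalence of product partial actions: there are a Morita equivalence
`M = (A, A', X, Y, τ_A, τ_{A'})` and a product partial action `θ` on its context algebra such that
`Y D_t X = D'_t` for all `t`, `θ|_A = α` and `θ|_{A'} = α'`. -/
def MoritaEquivalent (α : ProductPartialAction k G A) (α' : ProductPartialAction k G A') : Prop :=
  ∃ (X Y : Type (max uA uA')) (_ : AddCommGroup X) (_ : Module k X) (_ : AddCommGroup Y)
    (_ : Module k Y) (M : MoritaContext k A A' X Y) (θ : ProductPartialAction k G M.ContextAlgebra),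
    M.IsEquivalence ∧
    (∀ t, Submodule.map₂ M.τA' (Submodule.map₂ M.rY ⊤ (α.D t)) ⊤ = α'.D t) ∧
    θ.RestrictsTo M.inA α ∧ θ.RestrictsTo M.inA' α'

/-- Isomorphism of product partial actions. -/
def Isomorphic (α : ProductPartialAction k G A) (α' : ProductPartialAction k G A') : Prop :=
  ∃ φ : A →ₙₐ[k] A', Function.Bijective φ ∧ (∀ t, (α.D t).map (φ : A →ₗ[k] A') = α'.D t) ∧
    ∀ t (a : α.D t⁻¹) (b : α'.D t⁻¹), (b : A') = φ a → (α'.act t b : A') = φ (α.act t a)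

end Equivalences

end ProductPartialAction

section Globalization

universe uk uG uA uB

variable {k : Type uk} {G : Type uG} {A : Type uA} {B : Type uB} [CommRing k] [Group G]
    [NonUnitalRing A] [Module k A] [IsScalarTower k A A] [SMulCommClass k A A]
    [NonUnitalRing B] [Module k B] [IsScalarTower k B B] [SMulCommClass k B B]

/-- `β` is a minimal globalization of `α`: up to isomorphism, `α` is the restriction of `β` to an
idempotent ideal `I` of `B` with `I β_t(I) = β_t(I) I` for all `t`, and `B = ∑_t β_t(I)`. -/
def IsMinimalGlobalization (β : GlobalAction k G B) (α : ProductPartialAction k G A) : Prop :=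
  ∃ (I : NonUnitalSubalgebra k B) (hI : IsIdeal I.toSubmodule)
    (hidem : I.toSubmodule ⬝ₖ I.toSubmodule = I.toSubmodule)
    (hcomm : ∀ t, I.toSubmodule ⬝ₖ β.image t I.toSubmodule =
      β.image t I.toSubmodule ⬝ₖ I.toSubmodule),
    α.Isomorphic (β.restrict I hI hidem hcomm) ∧ ⨆ t, β.image t I.toSubmodule = ⊤

/-- `β` is a Morita enveloping action of `α`: it is a minimal globalization of a product partial
action that is Morita equivalent to `α`. -/
def IsMoritaEnvelopingAction (β : GlobalAction k G B) (α : ProductPartialAction k G A) : Prop :=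
  ∃ (A' : Type uB) (_ : NonUnitalRing A') (_ : Module k A') (_ : IsScalarTower k A' A')
    (_ : SMulCommClass k A' A') (α' : ProductPartialAction k G A'),
    α.MoritaEquivalent α' ∧ IsMinimalGlobalization β α'

end Globalization

end PartialActions

namespace PartialActions

/-! ### Pulling back products of submodules -/

section Products

variable {k A : Type*} [CommRing k] [NonUnitalRing A] [Module k A] [IsScalarTower k A A]
  [SMulCommClass k A A]

/-! Everything happens inside one algebra: the finite matrices over `A` indexed by G ∪ {∗}, where ∗
is an extra index of degree 1.

The partial smash product is a disguised algebra of matrices over `A`. Its (r, s) entries range over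
B_{r⁻¹} B_s = (D_{r⁻¹} D_{r⁻¹s}) δ_{r⁻¹s}, so their coefficients lie in the domain of α_r. Applying
α_r to the coefficient at (r, s) identifies I^B with the matrices whose (r, s) entry lies in D_r D_s
(`range_untwist`). The twist of the skew product disappears under this change (`twist_aux`,
`untwist_mul`), and γ^B_t becomes a e_{r,s} ↦ α_t(a) e_{tr,ts}, with domain D_t D_r D_s at (r, s)
(`untwist_mem_matDomain`, `untwist_act`).

With ∗ adjoined, the matrices with entries in D_{deg o} D_{deg o'} split into four blocks: `A` at
(∗, ∗), a row X with entries D_s, a column Y with entries D_r, and the copy of I^B. This is the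
context algebra. Its Morita conditions are computations with products of domains: X Y = ∑ D_r D_r =
A because D_1 = A, while Y X and Y D_t X have entries D_r D_s and D_r D_t D_s. The action θ is again
a e_{o,o'} ↦ α_t(a) e_{to,to'}, now with t∗ = ∗ (`matrixPartialAction`), so it restricts to α on one
diagonal corner and to γ^B on the other. Fixing ∗ does not respect degrees, but the defect is
invisible next to a factor D_t, because D_t D_1 = D_t = D_t D_t (`D_mul_optShift`).

No unit and no intersection of ideals is needed: the domains commute, are idempotent, and absorb D_1
= A.

Finally, γ^B is by construction the restriction of β^B to I^B, and the translates of I^B span: b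
e_{r,s} with b ∈ B_{r⁻¹s} = B_1 B_{r⁻¹s} lies in β_r(I^B). -/

theorem comap_mulSub {C E : Type*} [NonUnitalRing C] [Module k C] [IsScalarTower k C C]
    [SMulCommClass k C C] [NonUnitalRing E] [Module k E] [IsScalarTower k E E]
    [SMulCommClass k E E] (φ : C →ₗ[k] E) (hinj : Function.Injective φ)
    (hmul : ∀ x y, φ (x * y) = φ x * φ y) {S T : Submodule k E}
    (hS : S ≤ LinearMap.range φ) (hT : T ≤ LinearMap.range φ)
    (hST : S ⬝ₖ T ≤ LinearMap.range φ) :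
    S.comap φ ⬝ₖ T.comap φ = (S ⬝ₖ T).comap φ := by
  apply Submodule.map_injective_of_injective hinj
  rw [map_mulSub φ hmul, Submodule.map_comap_eq_of_le hS, Submodule.map_comap_eq_of_le hT,
    Submodule.map_comap_eq_of_le hST]

end Products

/-! ### Products of domains, and the partial isomorphisms as total functions -/

namespace ProductPartialAction

variable {k G A : Type*} [CommRing k] [Group G] [NonUnitalRing A]
    [Module k A] [IsScalarTower k A A] [SMulCommClass k A A] (α : ProductPartialAction k G A)

/-- Together with `mulSub_assoc`, `D_comm` and `D_left_idem` this sorts and contracts any product of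
domains. -/
theorem D_left_comm (s t : G) (U : Submodule k A) :
    α.D s ⬝ₖ (α.D t ⬝ₖ U) = α.D t ⬝ₖ (α.D s ⬝ₖ U) := by
  rw [← mulSub_assoc, α.D_comm, mulSub_assoc]

theorem D_left_idem (s : G) (U : Submodule k A) : α.D s ⬝ₖ (α.D s ⬝ₖ U) = α.D s ⬝ₖ U := by
  rw [← mulSub_assoc, α.D_idem]

/-- Idempotence replaces a unit of `A`: D_s = D_s D_s ⊆ D_s A. -/
theorem D_mul_one (s : G) : α.D s ⬝ₖ α.D 1 = α.D s := by
  apply le_antisymm (mulSub_le_left (α.isIdeal s))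
  conv_lhs => rw [← α.D_idem]
  exact mulSub_mono le_rfl (by rw [α.D_one]; exact le_top)

theorem D_one_mul (s : G) : α.D 1 ⬝ₖ α.D s = α.D s := by rw [α.D_comm, D_mul_one]

theorem D_one_mul_mul (s : G) (U : Submodule k A) :
    α.D 1 ⬝ₖ (α.D s ⬝ₖ U) = α.D s ⬝ₖ U := by
  rw [← mulSub_assoc, D_one_mul]

open Classical in
/-- The isomorphism `α_t`, extended by zero outside of its domain. -/
noncomputable def actFun (t : G) (a : A) : A :=
  if h : a ∈ α.D t⁻¹ then α.act t ⟨a, h⟩ else 0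

theorem actFun_of_mem {t : G} {a : A} (h : a ∈ α.D t⁻¹) : α.actFun t a = α.act t ⟨a, h⟩ :=
  dif_pos h

theorem actFun_mem {t : G} {a : A} (h : a ∈ α.D t⁻¹) : α.actFun t a ∈ α.D t := by
  rw [α.actFun_of_mem h]
  exact Subtype.property _

theorem actFun_zero (t : G) : α.actFun t 0 = 0 := by
  rw [α.actFun_of_mem (Submodule.zero_mem _)]
  exact congrArg Subtype.val (map_zero (α.act t))

theorem actFun_add {t : G} {a b : A} (ha : a ∈ α.D t⁻¹) (hb : b ∈ α.D t⁻¹) :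
    α.actFun t (a + b) = α.actFun t a + α.actFun t b := by
  rw [α.actFun_of_mem ha, α.actFun_of_mem hb, α.actFun_of_mem (Submodule.add_mem _ ha hb)]
  exact α.act_add' t _ _ _ rfl

theorem actFun_smul {t : G} (c : k) {a : A} (ha : a ∈ α.D t⁻¹) :
    α.actFun t (c • a) = c • α.actFun t a := by
  rw [α.actFun_of_mem ha, α.actFun_of_mem (Submodule.smul_mem _ c ha)]
  exact α.act_smul' t c _ _ rfl

theorem actFun_mul {t : G} {a b : A} (ha : a ∈ α.D t⁻¹) (hb : b ∈ α.D t⁻¹) :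
    α.actFun t (a * b) = α.actFun t a * α.actFun t b := by
  rw [α.actFun_of_mem ha, α.actFun_of_mem hb, α.actFun_of_mem (α.isIdeal _ a b hb).1]
  exact α.act_mul' t _ _ _ rfl

theorem actFun_sum {ι : Type*} {t : G} (T : Finset ι) (f : ι → A) (h : ∀ i, f i ∈ α.D t⁻¹) :
    α.actFun t (∑ i ∈ T, f i) = ∑ i ∈ T, α.actFun t (f i) := by
  classical
  induction T using Finset.induction_on with
  | empty => simp [actFun_zero]
  | insert i T hi ih =>
    rw [Finset.sum_insert hi, Finset.sum_insert hi,
      α.actFun_add (h i) (Submodule.sum_mem _ fun i _ => h i), ih]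

theorem actFun_one (a : A) : α.actFun 1 a = a := by
  have h : a ∈ α.D 1⁻¹ := by rw [inv_one, α.D_one]; trivial
  rw [α.actFun_of_mem h, α.act_one]

theorem actFun_mem_mulSub {s t : G} {a : A} (h : a ∈ α.D s⁻¹ ⬝ₖ α.D t) :
    α.actFun s a ∈ α.D s ⬝ₖ α.D (s * t) := by
  have ha : a ∈ α.D s⁻¹ := mulSub_le_left (α.isIdeal _) h
  rw [α.actFun_of_mem ha, ← SetLike.mem_coe, ← α.act_image]
  exact ⟨_, h, rfl⟩

theorem actFun_actFun {s t : G} {a : A} (h : a ∈ α.D t⁻¹ ⬝ₖ α.D (s * t)⁻¹) :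
    α.actFun s (α.actFun t a) = α.actFun (s * t) a := by
  have h1 : a ∈ α.D t⁻¹ := mulSub_le_left (α.isIdeal _) h
  have h2 : a ∈ α.D (s * t)⁻¹ := mulSub_le_right (α.isIdeal _) h
  -- The inner value is in the domain of α_s, since α_t maps D_{t⁻¹} D_{(st)⁻¹} into D_t D_{t(st)⁻¹}
  -- = D_t D_{s⁻¹}.
  have h3 : α.actFun t a ∈ α.D s⁻¹ := by
    have := mulSub_le_right (α.isIdeal _) (α.actFun_mem_mulSub h)
    simpa using this
  rw [α.actFun_of_mem h2, α.actFun_of_mem h3]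
  exact α.act_act s t ⟨a, h1⟩ _ _ h (α.actFun_of_mem h1) rfl

theorem actFun_inv_actFun {t : G} {a : A} (h : a ∈ α.D t⁻¹) :
    α.actFun t⁻¹ (α.actFun t a) = a := by
  rw [α.actFun_actFun, inv_mul_cancel, actFun_one]
  rwa [inv_mul_cancel, inv_one, D_mul_one]

theorem actFun_actFun_inv {t : G} {a : A} (h : a ∈ α.D t) :
    α.actFun t (α.actFun t⁻¹ a) = a := by
  have := α.actFun_inv_actFun (t := t⁻¹) (a := a) (by simpa using h)
  rwa [inv_inv] at this

theorem actFun_map_mulSub {s : G} {S T S' T' : Submodule k A} (hS : S ≤ α.D s⁻¹)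
    (hT : T ≤ α.D s⁻¹) (h : ∀ a ∈ S, α.actFun s a ∈ S') (h' : ∀ a ∈ T, α.actFun s a ∈ T')
    {a : A} (ha : a ∈ S ⬝ₖ T) : α.actFun s a ∈ S' ⬝ₖ T' := by
  -- `actFun` is linear only on D_{s⁻¹}, so membership there is carried along to make the good
  -- elements a submodule.
  have : a ∈ α.D s⁻¹ ∧ α.actFun s a ∈ S' ⬝ₖ T' := by
    refine (mulSub_le (U :=
      { carrier := {a | a ∈ α.D s⁻¹ ∧ α.actFun s a ∈ S' ⬝ₖ T'}
        add_mem' := fun ha hb => ⟨Submodule.add_mem _ ha.1 hb.1, by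
          rw [α.actFun_add ha.1 hb.1]
          exact Submodule.add_mem _ ha.2 hb.2⟩
        zero_mem' := ⟨Submodule.zero_mem _, by
          rw [actFun_zero]
          exact Submodule.zero_mem _⟩
        smul_mem' := fun c a ha => ⟨Submodule.smul_mem _ c ha.1, by
          rw [α.actFun_smul c ha.1]
          exact Submodule.smul_mem _ c ha.2⟩ })).2 ?_ ha
    intro x hx y hy
    refine ⟨(α.isIdeal _ x y (hT hy)).1, ?_⟩
    rw [α.actFun_mul (hS hx) (hT hy)]
    exact mul_mem_mulSub (h x hx) (h' y hy)
  exact this.2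

/-- Doubling the idempotent D_{s⁻¹} gives each further factor its own copy, D_{s⁻¹} D_t D_u =
(D_{s⁻¹} D_t)(D_{s⁻¹} D_u), and the multiplicative map α_s can be evaluated factor by factor. -/
theorem actFun_mem_mulSub₂ {s t u : G} {a : A} (h : a ∈ α.D s⁻¹ ⬝ₖ (α.D t ⬝ₖ α.D u)) :
    α.actFun s a ∈ α.D s ⬝ₖ (α.D (s * t) ⬝ₖ α.D (s * u)) := by
  have e : α.D s⁻¹ ⬝ₖ (α.D t ⬝ₖ α.D u) = (α.D s⁻¹ ⬝ₖ α.D t) ⬝ₖ (α.D s⁻¹ ⬝ₖ α.D u) := by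
    rw [mulSub_assoc, α.D_left_comm t, D_left_idem]
  have e' : α.D s ⬝ₖ (α.D (s * t) ⬝ₖ α.D (s * u)) =
      (α.D s ⬝ₖ α.D (s * t)) ⬝ₖ (α.D s ⬝ₖ α.D (s * u)) := by
    rw [mulSub_assoc, α.D_left_comm (s * t), D_left_idem]
  rw [e] at h
  rw [e']
  exact α.actFun_map_mulSub (mulSub_le_left (α.isIdeal _)) (mulSub_le_left (α.isIdeal _))
    (fun _ => α.actFun_mem_mulSub) (fun _ => α.actFun_mem_mulSub) h

theorem actFun_mem_mulSub₃ {s t u v : G} {a : A}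
    (h : a ∈ α.D s⁻¹ ⬝ₖ (α.D t ⬝ₖ (α.D u ⬝ₖ α.D v))) :
    α.actFun s a ∈ α.D s ⬝ₖ (α.D (s * t) ⬝ₖ (α.D (s * u) ⬝ₖ α.D (s * v))) := by
  have e : α.D s⁻¹ ⬝ₖ (α.D t ⬝ₖ (α.D u ⬝ₖ α.D v)) =
      (α.D s⁻¹ ⬝ₖ α.D t) ⬝ₖ (α.D s⁻¹ ⬝ₖ (α.D u ⬝ₖ α.D v)) := by
    rw [mulSub_assoc, α.D_left_comm t s⁻¹, D_left_idem]
  have e' : α.D s ⬝ₖ (α.D (s * t) ⬝ₖ (α.D (s * u) ⬝ₖ α.D (s * v))) =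
      (α.D s ⬝ₖ α.D (s * t)) ⬝ₖ (α.D s ⬝ₖ (α.D (s * u) ⬝ₖ α.D (s * v))) := by
    rw [mulSub_assoc, α.D_left_comm (s * t) s, D_left_idem]
  rw [e] at h
  rw [e']
  exact α.actFun_map_mulSub (mulSub_le_left (α.isIdeal _)) (mulSub_le_left (α.isIdeal _))
    (fun _ => α.actFun_mem_mulSub) (fun _ => α.actFun_mem_mulSub₂) h

end ProductPartialAction

/-! ### Partial actions on a subalgebra of an ambient algebra -/

/-- A product partial action on the subalgebra `N 1` of `E`, given by submodules `N t` of `E` and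
by functions on `E` whose values outside of the domains are irrelevant. -/
structure EmbeddedPartialAction (k G E : Type*) [CommRing k] [Group G] [NonUnitalRing E]
    [Module k E] [IsScalarTower k E E] [SMulCommClass k E E] where
  /-- the domains -/
  N : G → Submodule k E
  /-- the isomorphisms -/
  F : G → E → E
  N_mul_one : ∀ t, N t ⬝ₖ N 1 = N t
  N_le : ∀ t, N t ≤ N 1
  N_idem : ∀ t, N t ⬝ₖ N t = N t
  N_comm : ∀ s t, N s ⬝ₖ N t = N t ⬝ₖ N s
  F_add : ∀ t x y, x ∈ N t⁻¹ → y ∈ N t⁻¹ → F t (x + y) = F t x + F t y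
  F_smul : ∀ t (c : k) x, x ∈ N t⁻¹ → F t (c • x) = c • F t x
  F_mul : ∀ t x y, x ∈ N t⁻¹ → y ∈ N t⁻¹ → F t (x * y) = F t x * F t y
  F_one : ∀ x, x ∈ N 1 → F 1 x = x
  F_mem : ∀ s t x, x ∈ N s⁻¹ ⬝ₖ N t → F s x ∈ N s ⬝ₖ N (s * t)
  F_F : ∀ s t x, x ∈ N t⁻¹ ⬝ₖ N (s * t)⁻¹ → F s (F t x) = F (s * t) x

namespace EmbeddedPartialAction

variable {k G E : Type*} [CommRing k] [Group G] [NonUnitalRing E]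
    [Module k E] [IsScalarTower k E E] [SMulCommClass k E E] (P : EmbeddedPartialAction k G E)

/-- The case N_{t⁻¹} = N_{t⁻¹} N_{t⁻¹} of `F_mem`, whose target is N_t N_1 = N_t. -/
theorem F_mem_N {t : G} {x : E} (hx : x ∈ P.N t⁻¹) : P.F t x ∈ P.N t := by
  have := P.F_mem t t⁻¹ x (by rwa [P.N_idem])
  rwa [mul_inv_cancel, P.N_mul_one] at this

theorem F_inv_F {t : G} {x : E} (hx : x ∈ P.N t⁻¹) : P.F t⁻¹ (P.F t x) = x := by
  rw [P.F_F, inv_mul_cancel, P.F_one _ (P.N_le _ hx)]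
  rwa [inv_mul_cancel, inv_one, P.N_mul_one]

theorem F_F_inv {t : G} {x : E} (hx : x ∈ P.N t) : P.F t (P.F t⁻¹ x) = x := by
  have := P.F_inv_F (t := t⁻¹) (x := x) (by rwa [inv_inv])
  rwa [inv_inv] at this

theorem mulSub_N_le (s t : G) : P.N s ⬝ₖ P.N t ≤ P.N s := by
  conv_rhs => rw [← P.N_mul_one]
  exact mulSub_mono le_rfl (P.N_le t)

variable {C : Type*} [NonUnitalRing C] [Module k C] [IsScalarTower k C C]
    [SMulCommClass k C C]

theorem comap_N_mul (φ : C →ₗ[k] E) (hinj : Function.Injective φ)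
    (hmul : ∀ x y, φ (x * y) = φ x * φ y) (hrange : P.N 1 = LinearMap.range φ) (s t : G) :
    (P.N s).comap φ ⬝ₖ (P.N t).comap φ = (P.N s ⬝ₖ P.N t).comap φ :=
  comap_mulSub φ hinj hmul (hrange ▸ P.N_le s) (hrange ▸ P.N_le t)
    (hrange ▸ (P.mulSub_N_le s t).trans (P.N_le s))

/-- The isomorphism `F_t`, transported along `φ`. -/
noncomputable def pullbackAct (φ : C →ₗ[k] E) (hinj : Function.Injective φ)
    (hrange : P.N 1 = LinearMap.range φ) (t : G) :
    (P.N t⁻¹).comap φ ≃ₗ[k] (P.N t).comap φ :=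
  let e := LinearEquiv.ofInjective φ hinj
  have he : ∀ y, φ (e.symm y) = y := fun y => congrArg Subtype.val (e.apply_symm_apply y)
  have hF : ∀ (x : (P.N t⁻¹).comap φ), P.F t (φ x) ∈ P.N t := fun x => P.F_mem_N x.2
  have hF' : ∀ (x : (P.N t).comap φ), P.F t⁻¹ (φ x) ∈ P.N t⁻¹ := fun x =>
    P.F_mem_N (by rw [inv_inv]; exact x.2)
  have hr : ∀ {s : G} {y : E}, y ∈ P.N s → y ∈ LinearMap.range φ := fun hy =>
    hrange ▸ P.N_le _ hy
  { toFun := fun x => ⟨e.symm ⟨P.F t (φ x), hr (hF x)⟩, by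
      rw [Submodule.mem_comap, he]; exact hF x⟩
    map_add' := fun x y => Subtype.ext (hinj (by
      simp only [Submodule.coe_add, map_add, he]
      exact P.F_add t _ _ x.2 y.2))
    map_smul' := fun c x => Subtype.ext (hinj (by
      simp only [Submodule.coe_smul, map_smul, he]
      exact P.F_smul t c _ x.2))
    invFun := fun x => ⟨e.symm ⟨P.F t⁻¹ (φ x), hr (hF' x)⟩, by
      rw [Submodule.mem_comap, he]; exact hF' x⟩
    left_inv := fun x => Subtype.ext (hinj (by
      simp only [he]
      exact P.F_inv_F x.2))
    right_inv := fun x => Subtype.ext (hinj (by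
      simp only [he]
      exact P.F_F_inv x.2)) }

theorem map_pullbackAct (φ : C →ₗ[k] E) (hinj : Function.Injective φ)
    (hrange : P.N 1 = LinearMap.range φ) (t : G) (x : (P.N t⁻¹).comap φ) :
    φ (P.pullbackAct φ hinj hrange t x : C) = P.F t (φ x) :=
  congrArg Subtype.val (LinearEquiv.apply_symm_apply (LinearEquiv.ofInjective φ hinj) _)

/-- The algebra `N 1`, identified with the domain of `φ`, carries a product partial action. -/
noncomputable def pullback (φ : C →ₗ[k] E) (hinj : Function.Injective φ)
    (hmul : ∀ x y, φ (x * y) = φ x * φ y) (hrange : P.N 1 = LinearMap.range φ) :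
    ProductPartialAction k G C where
  D t := (P.N t).comap φ
  isIdeal t a x hx := by
    -- N_t is only an ideal of N_1, not of the ambient algebra; this suffices because φ takes values
    -- in N_1.
    have ha : φ a ∈ P.N 1 := hrange ▸ LinearMap.mem_range_self φ a
    have hx : φ x ∈ P.N t := hx
    have h := mul_mem_mulSub ha hx
    have h' := mul_mem_mulSub hx ha
    rw [P.N_comm, P.N_mul_one] at h
    rw [P.N_mul_one] at h'
    exact ⟨by rwa [Submodule.mem_comap, hmul], by rwa [Submodule.mem_comap, hmul]⟩
  act := P.pullbackAct φ hinj hrange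
  act_mul t x y := hinj (by
    refine Eq.trans ?_ (hmul _ _).symm
    rw [map_pullbackAct, map_pullbackAct, map_pullbackAct, hmul]
    exact P.F_mul t _ _ x.2 y.2)
  D_one := by rw [hrange]; exact eq_top_iff.2 fun x _ => ⟨x, rfl⟩
  act_one x := hinj (by
    rw [map_pullbackAct]
    exact P.F_one _ (P.N_le _ x.2))
  D_idem t := by rw [P.comap_N_mul φ hinj hmul hrange, P.N_idem]
  D_comm s t := by
    rw [P.comap_N_mul φ hinj hmul hrange, P.comap_N_mul φ hinj hmul hrange, P.N_comm]
  act_image s t := by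
    rw [P.comap_N_mul φ hinj hmul hrange, P.comap_N_mul φ hinj hmul hrange]
    ext a
    constructor
    · rintro ⟨x, hx, rfl⟩
      rw [SetLike.mem_coe, Submodule.mem_comap, map_pullbackAct]
      exact P.F_mem s t _ hx
    · intro ha
      have ha' : φ a ∈ P.N s := P.mulSub_N_le _ _ ha
      -- `F_mem` gives only one inclusion; the other is the same statement for s⁻¹ and st, as
      -- F_{s⁻¹} inverts F_s.
      have hx : P.F s⁻¹ (φ a) ∈ P.N s⁻¹ ⬝ₖ P.N t := by
        have := P.F_mem s⁻¹ (s * t) (φ a) (by rwa [inv_inv])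
        rwa [inv_mul_cancel_left] at this
      have hx' := P.mulSub_N_le _ _ hx
      obtain ⟨c, hc⟩ : P.F s⁻¹ (φ a) ∈ LinearMap.range φ := hrange ▸ P.N_le _ hx'
      refine ⟨⟨c, by rwa [Submodule.mem_comap, hc]⟩, by rwa [Submodule.mem_comap, hc], hinj ?_⟩
      rw [map_pullbackAct]
      simp only [hc]
      exact P.F_F_inv ha'
  act_act s t x y z hx hy hz := hinj (by
    rw [P.comap_N_mul φ hinj hmul hrange] at hx
    rw [map_pullbackAct, map_pullbackAct, hy, map_pullbackAct, hz]
    exact P.F_F s t _ hx)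

end EmbeddedPartialAction
end PartialActions

namespace PartialActions

/-! ### Finite matrices over an arbitrary index set -/

namespace FMat

section Entries

variable {H B : Type*} [NonUnitalRing B]

theorem exists_column_bound (f : FMat H B) : ∃ T : Finset H, ∀ r s, f.entry r s ≠ 0 → s ∈ T := by
  classical
  refine ⟨(Finsupp.support f).image Prod.snd, fun r s h => ?_⟩
  exact Finset.mem_image.2 ⟨(r, s), Finsupp.mem_support_iff.2 h, rfl⟩

/-- Taking one entry, as an additive map. -/
def entryHom (r s : H) : FMat H B →+ B where
  toFun f := f.entry r s
  map_zero' := rfl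
  map_add' _ _ := rfl

theorem entry_sum {ι : Type*} (T : Finset ι) (f : ι → FMat H B) (r s : H) :
    (∑ i ∈ T, f i).entry r s = ∑ i ∈ T, (f i).entry r s :=
  map_sum (entryHom r s) f T

/-- The summation set is any finite set containing the nonzero columns of the left factor, so that
it can be transported when the indices are translated or embedded. -/
theorem entry_mul (f g : FMat H B) (T : Finset H) (hT : ∀ r s, f.entry r s ≠ 0 → s ∈ T)
    (r v : H) : (f * g).entry r v = ∑ s ∈ T, f.entry r s * g.entry s v := by
  classical
  -- By bilinearity it is enough to multiply matrix units; the hypothesis on the column ensures that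
  -- the one nonzero summand is counted.
  have key : ∀ (u w : H) (b : B), w ∈ T →
      (unit u w b * g).entry r v = ∑ s ∈ T, (unit u w b).entry r s * g.entry s v := by
    intro u w b hw
    refine induction (p := fun g => (unit u w b * g).entry r v =
      ∑ s ∈ T, (unit u w b).entry r s * g.entry s v) g (by simp) (fun g g' h h' => ?_)
      fun x y c => ?_
    · simp only [mul_add, entry_add, h, h', Finset.sum_add_distrib]
    · rw [Finset.sum_eq_single w]
      · rw [unit_mul_unit]
        simp only [entry_unit]
        by_cases h1 : w = x <;> by_cases h2 : u = r <;> by_cases h3 : y = v <;>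
          simp [h1, h2, h3, entry_unit, eq_comm]
      · intro s _ hs
        simp [entry_unit, hs.symm]
      · exact fun h => absurd hw h
  have hf : f = ∑ p ∈ Finsupp.support f, unit p.1 p.2 (f.entry p.1 p.2) := eq_sum f
  conv_lhs => rw [hf]
  rw [Finset.sum_mul, entry_sum, Finset.sum_congr rfl fun p hp =>
    key p.1 p.2 _ (hT p.1 p.2 (Finsupp.mem_support_iff.1 hp)), Finset.sum_comm]
  refine Finset.sum_congr rfl fun s _ => ?_
  rw [← Finset.sum_mul, ← entry_sum, ← hf]

variable {k : Type*} [CommRing k] [Module k B]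

theorem entriesIn_mono {F F' : H → H → Submodule k B} (h : ∀ r s, F r s ≤ F' r s) :
    entriesIn F ≤ entriesIn F' := fun _ hf r s => h r s (hf r s)

/-- Stated without a group structure on the indices, since G ∪ {∗} carries none. -/
theorem unit_mem_entriesIn' {F : H → H → Submodule k B} {r s : H} {b : B} (hb : b ∈ F r s) :
    unit r s b ∈ entriesIn F := by
  classical
  intro u v
  rw [entry_unit]
  split_ifs with h
  · obtain ⟨rfl, rfl⟩ := h
    exact hb
  · exact Submodule.zero_mem _

/-- The map `b ↦ b e_{r,s}`, as a linear map. -/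
noncomputable def unitHom (k : Type*) [CommRing k] [Module k B] (r s : H) : B →ₗ[k] FMat H B where
  toFun := unit r s
  map_add' := unit_add r s
  map_smul' c b := unit_smul c r s b

/-- A finite matrix is the sum of its entries times matrix units, so inclusions can be tested on
single entries. -/
theorem entriesIn_le {F : H → H → Submodule k B} {S : Submodule k (FMat H B)}
    (h : ∀ r s, F r s ≤ S.comap (unitHom k r s)) : entriesIn F ≤ S := by
  intro f hf
  rw [eq_sum f]
  exact Submodule.sum_mem _ fun p _ => h p.1 p.2 (hf p.1 p.2)

theorem entriesIn_mul_entriesIn [IsScalarTower k B B] [SMulCommClass k B B]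
    (F F' : H → H → Submodule k B) :
    entriesIn F ⬝ₖ entriesIn F' = entriesIn fun r v => ⨆ s, F r s ⬝ₖ F' s v := by
  apply le_antisymm
  · rw [mulSub_le]
    intro f hf g hg r v
    exact entry_mul_mem f g r v _ fun s =>
      Submodule.mem_iSup_of_mem s (mul_mem_mulSub (hf r s) (hg s v))
  · refine entriesIn_le fun r v => iSup_le fun s => mulSub_le.2 fun b hb c hc => ?_
    change unit r v (b * c) ∈ entriesIn F ⬝ₖ entriesIn F'
    rw [← unit_mul_unit_same r s v]
    exact mul_mem_mulSub (unit_mem_entriesIn' hb) (unit_mem_entriesIn' hc)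

end Entries

end FMat

/-! ### The partial action on matrices indexed by G ∪ {∗} -/

/-- The degree of an index in `G ∪ {∗}`, where `∗` has degree `1`. -/
def optDeg {G : Type*} [Group G] (o : Option G) : G := o.getD 1

/-- The translation by `t` of the index set `G ∪ {∗}`, where `∗` is fixed. -/
def optShift {G : Type*} [Group G] (t : G) : Option G ≃ Option G :=
  Equiv.optionCongr (Equiv.mulLeft t)

section OptShift

variable {G : Type*} [Group G]

theorem optShift_none (t : G) : optShift t none = none := rfl

theorem optShift_some (t r : G) : optShift t (some r) = some (t * r) := rfl

theorem optShift_one (o : Option G) : optShift 1 o = o := by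
  cases o <;> simp [optShift_none, optShift_some]

theorem optShift_mul (s t : G) (o : Option G) :
    optShift (s * t) o = optShift s (optShift t o) := by
  cases o <;> simp [optShift_none, optShift_some, mul_assoc]

theorem optShift_symm (t : G) (o : Option G) : (optShift t).symm o = optShift t⁻¹ o := by
  rw [Equiv.symm_apply_eq, ← optShift_mul, mul_inv_cancel, optShift_one]

end OptShift

namespace ProductPartialAction

variable {k G A : Type*} [CommRing k] [Group G] [NonUnitalRing A]
    [Module k A] [IsScalarTower k A A] [SMulCommClass k A A] (α : ProductPartialAction k G A)

/-- Translation multiplies degrees by t except at ∗, where the degree stays 1 instead of becoming t.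
A neighbouring D_t hides the difference: D_t D_1 = D_t = D_t D_t. -/
theorem D_mul_optShift (t : G) (o : Option G) (U : Submodule k A) :
    α.D t ⬝ₖ (α.D (optDeg (optShift t o)) ⬝ₖ U) = α.D t ⬝ₖ (α.D (t * optDeg o) ⬝ₖ U) := by
  cases o with
  | none => simp only [optShift_none, optDeg, Option.getD_none, mul_one, ← mulSub_assoc,
      D_mul_one, α.D_idem]
  | some r => rfl

theorem D_mul_optShift₂ (t : G) (o o' : Option G) (U : Submodule k A) :
    α.D t ⬝ₖ (α.D (optDeg (optShift t o)) ⬝ₖ (α.D (optDeg (optShift t o')) ⬝ₖ U)) =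
      α.D t ⬝ₖ (α.D (t * optDeg o) ⬝ₖ (α.D (t * optDeg o') ⬝ₖ U)) := by
  rw [D_mul_optShift, α.D_left_comm t (t * optDeg o), D_mul_optShift,
    α.D_left_comm (t * optDeg o) t]

/-- The matrices over `A`, indexed by `G ∪ {∗}`, with entries in `D_t D_r D_s` at `(r, s)`. -/
def matDomain (t : G) : Submodule k (FMat (Option G) A) :=
  FMat.entriesIn fun o o' => α.D t ⬝ₖ (α.D (optDeg o) ⬝ₖ α.D (optDeg o'))

theorem isIdeal_mulSub₂ (s t u : G) : IsIdeal (α.D s ⬝ₖ (α.D t ⬝ₖ α.D u)) :=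
  (α.isIdeal s).mulSub ((α.isIdeal t).mulSub (α.isIdeal u))

/-- The contribution of a middle index h is D_h times the claimed product of ideals. It is therefore
contained in that product, and h = ∗ attains it because D_1 is absorbed. -/
theorem matDomain_mul (s t : G) : α.matDomain s ⬝ₖ α.matDomain t =
    FMat.entriesIn fun o o' => α.D s ⬝ₖ (α.D t ⬝ₖ (α.D (optDeg o) ⬝ₖ α.D (optDeg o'))) := by
  rw [matDomain, matDomain, FMat.entriesIn_mul_entriesIn]
  congr 1
  funext o o'
  have e : ∀ h, (α.D s ⬝ₖ (α.D (optDeg o) ⬝ₖ α.D h)) ⬝ₖ (α.D t ⬝ₖ (α.D h ⬝ₖ α.D (optDeg o'))) =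
      α.D h ⬝ₖ (α.D s ⬝ₖ (α.D t ⬝ₖ (α.D (optDeg o) ⬝ₖ α.D (optDeg o')))) := by
    intro h
    simp only [mulSub_assoc, α.D_comm, α.D_left_comm, α.D_left_idem]
  apply le_antisymm
  · refine iSup_le fun h => ?_
    rw [e]
    exact mulSub_le_right ((α.isIdeal s).mulSub (α.isIdeal_mulSub₂ _ _ _))
  · refine le_trans ?_ (le_iSup _ none)
    rw [e]
    simp only [optDeg, Option.getD_none]
    rw [D_one_mul_mul]

theorem matDomain_mul_one (t : G) : α.matDomain t ⬝ₖ α.matDomain 1 = α.matDomain t := by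
  rw [matDomain_mul]
  simp only [D_one_mul_mul]
  rfl

theorem entry_mem_of_mem_matDomain {t : G} {f : FMat (Option G) A} (hf : f ∈ α.matDomain t)
    (o o' : Option G) : f.entry o o' ∈ α.D t :=
  mulSub_le_left (α.isIdeal t) (hf o o')

/-- The matrix with entry `α_t (a_{r,s})` at `(t r, t s)`. -/
noncomputable def matAct (t : G) (f : FMat (Option G) A) : FMat (Option G) A :=
  Finsupp.equivMapDomain ((optShift t).prodCongr (optShift t))
    (Finsupp.mapRange (α.actFun t) (α.actFun_zero t) f)

theorem entry_matAct (t : G) (f : FMat (Option G) A) (o o' : Option G) :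
    (α.matAct t f).entry o o' =
      α.actFun t (f.entry (optShift t⁻¹ o) (optShift t⁻¹ o')) := by
  rw [← optShift_symm, ← optShift_symm]
  rfl

theorem entry_matAct_optShift (t : G) (f : FMat (Option G) A) (o o' : Option G) :
    (α.matAct t f).entry (optShift t o) (optShift t o') = α.actFun t (f.entry o o') := by
  rw [entry_matAct, ← optShift_mul, ← optShift_mul, inv_mul_cancel, optShift_one, optShift_one]

/-- Translation permutes the indices, so comparing at translated positions is enough and keeps
inverses out of the formulas. -/
theorem fmat_ext_optShift (t : G) {f g : FMat (Option G) A}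
    (h : ∀ o o', f.entry (optShift t o) (optShift t o') =
      g.entry (optShift t o) (optShift t o')) : f = g := by
  refine FMat.ext fun o o' => ?_
  have := h (optShift t⁻¹ o) (optShift t⁻¹ o')
  simpa only [← optShift_mul, mul_inv_cancel, optShift_one] using this

theorem matAct_mul (t : G) {f g : FMat (Option G) A} (hf : f ∈ α.matDomain t⁻¹)
    (hg : g ∈ α.matDomain t⁻¹) : α.matAct t (f * g) = α.matAct t f * α.matAct t g := by
  classical
  refine fmat_ext_optShift t fun o o' => ?_
  obtain ⟨T, hT⟩ := f.exists_column_bound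
  rw [entry_matAct_optShift, FMat.entry_mul f g T hT,
    -- If T contains the nonzero columns of f, then the translate tT contains those of its image.
    FMat.entry_mul (α.matAct t f) _ (T.map (optShift t).toEmbedding)]
  · rw [Finset.sum_map, α.actFun_sum]
    · refine Finset.sum_congr rfl fun s _ => ?_
      rw [Equiv.coe_toEmbedding, entry_matAct_optShift, entry_matAct_optShift, α.actFun_mul]
      · exact α.entry_mem_of_mem_matDomain hf _ _
      · exact α.entry_mem_of_mem_matDomain hg _ _
    · intro s
      exact (α.isIdeal _ _ _ (α.entry_mem_of_mem_matDomain hg _ _)).1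
  · intro r s h
    rw [entry_matAct] at h
    refine Finset.mem_map.2 ⟨optShift t⁻¹ s, hT (optShift t⁻¹ r) _ fun h0 => h ?_, ?_⟩
    · rw [h0, actFun_zero]
    · rw [Equiv.coe_toEmbedding, ← optShift_mul, mul_inv_cancel, optShift_one]

/-- The matrix partial action `a e_{r,s} ↦ α_t (a) e_{tr,ts}`, where `r, s ∈ G ∪ {∗}`. -/
noncomputable def matrixPartialAction : EmbeddedPartialAction k G (FMat (Option G) A) where
  N := α.matDomain
  F := α.matAct
  N_mul_one := α.matDomain_mul_one
  N_le t := by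
    refine FMat.entriesIn_mono fun o o' => ?_
    rw [D_one_mul_mul]
    exact mulSub_le_right ((α.isIdeal _).mulSub (α.isIdeal _))
  N_idem t := by
    rw [matDomain_mul]
    simp only [D_left_idem]
    rfl
  N_comm s t := by
    rw [matDomain_mul, matDomain_mul]
    simp only [α.D_left_comm s t]
  F_add t f g hf hg := by
    refine FMat.ext fun o o' => ?_
    simp only [entry_matAct, FMat.entry_add]
    exact α.actFun_add (α.entry_mem_of_mem_matDomain hf _ _) (α.entry_mem_of_mem_matDomain hg _ _)
  F_smul t c f hf := by
    refine FMat.ext fun o o' => ?_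
    simp only [entry_matAct, FMat.entry_smul]
    exact α.actFun_smul c (α.entry_mem_of_mem_matDomain hf _ _)
  F_mul t f g hf hg := α.matAct_mul t hf hg
  F_one f _ := by
    refine FMat.ext fun o o' => ?_
    simp only [entry_matAct, actFun_one, inv_one, optShift_one]
  F_mem s t f hf := by
    rw [matDomain_mul] at hf ⊢
    intro o o'
    have h := α.actFun_mem_mulSub₃ (hf (optShift s⁻¹ o) (optShift s⁻¹ o'))
    rw [entry_matAct]
    -- α_s produces the degrees s · deg o, while the domain asks for deg (s · o); they agree in the
    -- presence of D_s. A trailing D_1 is inserted to match the shape of `D_mul_optShift₂`.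
    have e : ∀ o o', α.D s ⬝ₖ (α.D (s * t) ⬝ₖ (α.D (s * optDeg o) ⬝ₖ α.D (s * optDeg o'))) =
        α.D s ⬝ₖ (α.D (s * t) ⬝ₖ (α.D (optDeg (optShift s o)) ⬝ₖ
          α.D (optDeg (optShift s o')))) := by
      intro o o'
      rw [α.D_left_comm s (s * t), α.D_left_comm s (s * t), ← D_mul_one _ (s * optDeg o'),
        ← D_mul_one _ (optDeg (optShift s o')), D_mul_optShift₂]
    rw [e] at h
    simpa only [← optShift_mul, mul_inv_cancel, optShift_one] using h
  F_F s t f hf := by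
    rw [matDomain_mul] at hf
    refine FMat.ext fun o o' => ?_
    rw [entry_matAct, entry_matAct, entry_matAct, α.actFun_actFun, ← optShift_mul, ← optShift_mul,
      mul_inv_rev]
    have h := hf (optShift t⁻¹ (optShift s⁻¹ o)) (optShift t⁻¹ (optShift s⁻¹ o'))
    -- Composing α_s with α_t requires only the first two factors D_{t⁻¹} D_{(st)⁻¹}; those from the
    -- position of the entry are dropped.
    refine mulSub_le_left (T := α.D (optDeg (optShift t⁻¹ (optShift s⁻¹ o))) ⬝ₖ
      α.D (optDeg (optShift t⁻¹ (optShift s⁻¹ o')))) ?_ ?_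
    · exact (α.isIdeal _).mulSub (α.isIdeal _)
    · rw [mulSub_assoc]
      exact h

end ProductPartialAction
end PartialActions

namespace PartialActions
namespace ProductPartialAction

/-! ### The partial smash product as an algebra of matrices over A -/

section SmashMatrix

variable {k G A : Type*} [CommRing k] [Group G] [NonUnitalRing A]
    [Module k A] [IsScalarTower k A A] [SMulCommClass k A A] (α : ProductPartialAction k G A)

/-- The coefficient of `δ_t`, regarded as an element of `A`. -/
noncomputable def coef (t : G) : α.SkewGroupAlgebra →ₗ[k] A :=
  (α.D t).subtype ∘ₗ DirectSum.component k G (fun t => α.D t) t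

theorem coef_delta (t : G) (a : α.D t) : α.coef t (α.delta t a) = a := by
  classical
  exact congrArg Subtype.val (DirectSum.component.lof_self (M := fun t => α.D t) k t a)

theorem coef_mem (t : G) (x : α.SkewGroupAlgebra) : α.coef t x ∈ α.D t := Subtype.property _

theorem eq_delta_coef {t : G} {x : α.SkewGroupAlgebra} (hx : x ∈ α.grading.comp t) :
    x = α.delta t ⟨α.coef t x, α.coef_mem t x⟩ := by
  obtain ⟨a, rfl⟩ := hx
  congr 1
  exact Subtype.ext (α.coef_delta t a).symm

theorem actFun_inv_eq_symm {t : G} (a : α.D t) : α.actFun t⁻¹ a = (α.act t).symm a := by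
  have h := α.actFun_of_mem ((α.act t).symm a).2
  rw [Subtype.coe_eta, LinearEquiv.apply_symm_apply] at h
  rw [← h]
  exact α.actFun_inv_actFun ((α.act t).symm a).2

theorem coef_mul {s t : G} {x y : α.SkewGroupAlgebra} (hx : x ∈ α.grading.comp s)
    (hy : y ∈ α.grading.comp t) : α.coef (s * t) (x * y) =
      α.actFun s (α.actFun s⁻¹ (α.coef s x) * α.coef t y) := by
  obtain ⟨a, rfl⟩ := hx
  obtain ⟨b, rfl⟩ := hy
  rw [delta_mul_delta, coef_delta, coef_delta, coef_delta, coeff_apply, actFun_inv_eq_symm,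
    ← actFun_of_mem]

/-- The elements `a δ_t` with `a ∈ S`. -/
noncomputable def liftSub (S : Submodule k A) (t : G) : Submodule k α.SkewGroupAlgebra :=
  (S.comap (α.D t).subtype).map (α.delta t)

theorem mem_liftSub {S : Submodule k A} {t : G} {x : α.SkewGroupAlgebra} :
    x ∈ α.liftSub S t ↔ x ∈ α.grading.comp t ∧ α.coef t x ∈ S := by
  constructor
  · rintro ⟨a, ha, rfl⟩
    exact ⟨⟨a, rfl⟩, by rw [coef_delta]; exact ha⟩
  · rintro ⟨hx, h⟩
    exact ⟨_, h, (α.eq_delta_coef hx).symm⟩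

theorem liftSub_D (t : G) : α.liftSub (α.D t) t = α.grading.comp t := by
  ext x
  rw [mem_liftSub]
  exact ⟨fun h => h.1, fun h => ⟨h, α.coef_mem t x⟩⟩

/-- Since (α_r(u) δ_r)(b δ_s) = α_r(ub) δ_{rs}, the product has coefficients α_r(D_{r⁻¹} S). The
hypotheses on S' say that it is this image. -/
theorem comp_mulSub_liftSub {S S' : Submodule k A} {r s : G} (hS : S ≤ α.D s)
    (h₁ : ∀ a ∈ α.D r⁻¹ ⬝ₖ S, α.actFun r a ∈ S') (h₂ : ∀ a ∈ S', α.actFun r⁻¹ a ∈ α.D r⁻¹ ⬝ₖ S)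
    (hS' : S' ≤ α.D r) : α.grading.comp r ⬝ₖ α.liftSub S s = α.liftSub S' (r * s) := by
  apply le_antisymm
  · refine mulSub_le.2 fun x hx y hy => ?_
    rw [mem_liftSub] at hy ⊢
    refine ⟨α.grading.mul_mem _ _ _ _ hx hy.1, ?_⟩
    rw [α.coef_mul hx hy.1]
    refine h₁ _ (mul_mem_mulSub (α.actFun_mem ?_) hy.2)
    rw [inv_inv]
    exact α.coef_mem r x
  · intro x hx
    rw [mem_liftSub] at hx
    -- Every α_r(a) with a in D_{r⁻¹} S is the coefficient of some element of the product.
    -- Membership in D_{r⁻¹} is again recorded so that α_r is additive.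
    have key : ∀ a ∈ α.D r⁻¹ ⬝ₖ S, a ∈ α.D r⁻¹ ∧ ∃ y ∈ α.grading.comp r ⬝ₖ α.liftSub S s,
        α.coef (r * s) y = α.actFun r a := by
      intro a ha
      refine (mulSub_le (U :=
        { carrier := {a | a ∈ α.D r⁻¹ ∧ ∃ y ∈ α.grading.comp r ⬝ₖ α.liftSub S s,
            α.coef (r * s) y = α.actFun r a}
          add_mem' := ?_
          zero_mem' := ⟨Submodule.zero_mem _, 0, Submodule.zero_mem _, by
            rw [map_zero, actFun_zero]⟩
          smul_mem' := ?_ })).2 ?_ ha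
      · rintro a b ⟨ha, y, hy, hya⟩ ⟨hb, z, hz, hzb⟩
        exact ⟨Submodule.add_mem _ ha hb, y + z, Submodule.add_mem _ hy hz, by
          rw [map_add, hya, hzb, α.actFun_add ha hb]⟩
      · rintro c a ⟨ha, y, hy, hya⟩
        exact ⟨Submodule.smul_mem _ c ha, c • y, Submodule.smul_mem _ c hy, by
          rw [map_smul, hya, α.actFun_smul c ha]⟩
      · intro u hu b hb
        -- The left factor has coefficient α_r(u), so that the α_r⁻¹ in the skew product returns u.
        refine ⟨(α.isIdeal _ b u hu).2, α.delta r ⟨α.actFun r u, α.actFun_mem hu⟩ *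
          α.delta s ⟨b, hS hb⟩, mul_mem_mulSub ⟨_, rfl⟩ ⟨_, hb, rfl⟩, ?_⟩
        rw [α.coef_mul ⟨_, rfl⟩ ⟨_, rfl⟩, coef_delta, coef_delta, α.actFun_inv_actFun hu]
    obtain ⟨-, y, hy, hya⟩ := key _ (h₂ _ hx.2)
    rw [α.actFun_actFun_inv (hS' hx.2)] at hya
    have hyc : y ∈ α.grading.comp (r * s) := by
      refine mulSub_le.2 (fun x hx z hz => ?_) hy
      exact α.grading.mul_mem _ _ _ _ hx (α.mem_liftSub.1 hz).1
    have : x = y := by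
      rw [α.eq_delta_coef hx.1, α.eq_delta_coef hyc]
      congr 1
      exact Subtype.ext hya.symm
    rwa [this]

theorem comp_mulSub_comp (r s : G) :
    α.grading.comp r ⬝ₖ α.grading.comp s = α.liftSub (α.D r ⬝ₖ α.D (r * s)) (r * s) := by
  rw [← liftSub_D _ s]
  refine α.comp_mulSub_liftSub le_rfl (fun _ => α.actFun_mem_mulSub) (fun a ha => ?_)
    (mulSub_le_left (α.isIdeal _))
  have := α.actFun_mem_mulSub (s := r⁻¹) (t := r * s) (by rwa [inv_inv])
  rwa [inv_mul_cancel_left] at this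

theorem comp_mulSub_liftSub_D (r s t u : G) (h : α.D t ⬝ₖ α.D u ≤ α.D s) :
    α.grading.comp r ⬝ₖ α.liftSub (α.D t ⬝ₖ α.D u) s =
      α.liftSub (α.D r ⬝ₖ (α.D (r * t) ⬝ₖ α.D (r * u))) (r * s) := by
  refine α.comp_mulSub_liftSub h (fun _ => α.actFun_mem_mulSub₂) (fun a ha => ?_)
    (mulSub_le_left (α.isIdeal _))
  have := α.actFun_mem_mulSub₂ (s := r⁻¹) (t := r * t) (u := r * u) (by rwa [inv_inv])
  rwa [inv_mul_cancel_left, inv_mul_cancel_left] at this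

/-- With r⁻¹ in place of r, the left side is the (r, s) entry of I β_t(I), by `smash_mul_image`;
this makes the domains of γ^B explicit. -/
theorem comp_mulSub_comp₄ (r s t : G) :
    α.grading.comp r ⬝ₖ (α.grading.comp t ⬝ₖ α.grading.comp t⁻¹ ⬝ₖ α.grading.comp s) =
      α.liftSub (α.D r ⬝ₖ (α.D (r * t) ⬝ₖ α.D (r * s))) (r * s) := by
  rw [mulSub_assoc, comp_mulSub_comp, comp_mulSub_liftSub_D, mul_inv_cancel, mul_inv_cancel_left,
    D_one_mul, comp_mulSub_liftSub_D]
  · exact mulSub_le_right (α.isIdeal _)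
  · exact mulSub_le_right (α.isIdeal _)

/-- The untwisting identity: composing α_r with α_{r⁻¹s} gives α_s, which is multiplicative and
turns α_{s⁻¹r}(a) b into α_r(a) α_s(b). The membership statement makes α_r applicable, and additive,
on sums of such coefficients. -/
theorem twist_aux {r s : G} {a b : A} (ha : a ∈ α.D r⁻¹ ⬝ₖ α.D (r⁻¹ * s)) (hb : b ∈ α.D s⁻¹) :
    α.actFun (r⁻¹ * s) (α.actFun (r⁻¹ * s)⁻¹ a * b) ∈ α.D r⁻¹ ∧
      α.actFun r (α.actFun (r⁻¹ * s) (α.actFun (r⁻¹ * s)⁻¹ a * b)) =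
        α.actFun r a * α.actFun s b := by
  have hp : α.actFun r a ∈ α.D r ⬝ₖ α.D s := by
    have := α.actFun_mem_mulSub ha
    rwa [mul_inv_cancel_left] at this
  have hq : α.actFun s b ∈ α.D s := α.actFun_mem hb
  have hps : α.actFun r a ∈ α.D s := mulSub_le_right (α.isIdeal _) hp
  have ha' : α.actFun (r⁻¹ * s)⁻¹ a = α.actFun s⁻¹ (α.actFun r a) := by
    have e : (r⁻¹ * s)⁻¹ = s⁻¹ * r := by group
    rw [e, α.actFun_actFun]
    rw [← e, inv_inv]
    exact ha
  -- Written this way, the product comes from an element of D_s D_r. Hence it lies in D_{s⁻¹}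
  -- D_{s⁻¹r}, which is what the composition law needs.
  have hz : α.actFun (r⁻¹ * s)⁻¹ a * b = α.actFun s⁻¹ (α.actFun r a * α.actFun s b) := by
    rw [α.actFun_mul (by rwa [inv_inv]) (by rwa [inv_inv]), α.actFun_inv_actFun hb, ha']
  have hzm : α.actFun s⁻¹ (α.actFun r a * α.actFun s b) ∈ α.D (r⁻¹ * s)⁻¹ ⬝ₖ α.D s⁻¹ := by
    have := α.actFun_mem_mulSub (s := s⁻¹) (t := r) (a := α.actFun r a * α.actFun s b) (by
      rw [inv_inv, ← α.D_comm]
      exact mul_mem_mulSub (mulSub_le_left (α.isIdeal _) hp) hq)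
    rw [α.D_comm] at this
    convert this using 3
    group
  rw [hz]
  constructor
  · have := mulSub_le_right (α.isIdeal _) (α.actFun_mem_mulSub hzm)
    rwa [mul_inv_cancel_right] at this
  · rw [α.actFun_actFun, mul_inv_cancel_left, α.actFun_actFun_inv (α.isIdeal _ _ _ hps).2]
    rwa [mul_inv_cancel_left]

open Classical in
/-- The matrix over `A` with entry `α_r (a)` at `(r, s)`, if `a δ_{r⁻¹s}` is the given entry at
`(r, s)`. -/
noncomputable def untwistFun (f : FMat G α.SkewGroupAlgebra) : FMat (Option G) A :=
  Finsupp.onFinset ((Finsupp.support f).image fun p => (some p.1, some p.2))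
    (fun q => match q with
      | (some r, some s) => α.actFun r (α.coef (r⁻¹ * s) (f.entry r s))
      | _ => 0)
    (by
      rintro ⟨_ | r, _ | s⟩ h
      · exact absurd rfl h
      · exact absurd rfl h
      · exact absurd rfl h
      · refine Finset.mem_image.2 ⟨(r, s), Finsupp.mem_support_iff.2 fun h0 => h ?_, rfl⟩
        change α.actFun r (α.coef (r⁻¹ * s) (f.entry r s)) = 0
        rw [show f.entry r s = 0 from h0, map_zero, actFun_zero])

theorem entry_untwistFun_some (f : FMat G α.SkewGroupAlgebra) (r s : G) :
    (α.untwistFun f).entry (some r) (some s) = α.actFun r (α.coef (r⁻¹ * s) (f.entry r s)) := rfl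

theorem entry_untwistFun_none_left (f : FMat G α.SkewGroupAlgebra) (o : Option G) :
    (α.untwistFun f).entry none o = 0 := rfl

theorem entry_untwistFun_none_right (f : FMat G α.SkewGroupAlgebra) (o : Option G) :
    (α.untwistFun f).entry o none = 0 := by
  cases o <;> rfl

/-- The reason for working on I^B: for a general element of B # G the coefficient at (r, s) need not
lie in the domain of α_r. -/
theorem coef_mem_of_partialSmash (f : partialSmash α.grading) (r s : G) :
    α.coef (r⁻¹ * s) (((f : smash α.grading) : FMat G α.SkewGroupAlgebra).entry r s) ∈
      α.D r⁻¹ ⬝ₖ α.D (r⁻¹ * s) := by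
  have h := f.2 r s
  rw [comp_mulSub_comp, mem_liftSub] at h
  exact h.2

theorem coef_mem_D_of_partialSmash (f : partialSmash α.grading) (r s : G) :
    α.coef (r⁻¹ * s) (((f : smash α.grading) : FMat G α.SkewGroupAlgebra).entry r s) ∈
      α.D r⁻¹ :=
  mulSub_le_left (α.isIdeal _) (α.coef_mem_of_partialSmash f r s)

/-- The embedding of the partial smash product into the matrices over `A`. -/
noncomputable def untwist : partialSmash α.grading →ₗ[k] FMat (Option G) A where
  toFun f := α.untwistFun (f : smash α.grading)
  map_add' f g := by
    refine FMat.ext fun o o' => ?_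
    rcases o with _ | r
    · simp [entry_untwistFun_none_left]
    rcases o' with _ | s
    · simp [entry_untwistFun_none_right]
    rw [FMat.entry_add]
    simp only [entry_untwistFun_some]
    rw [← α.actFun_add (α.coef_mem_D_of_partialSmash f r s) (α.coef_mem_D_of_partialSmash g r s),
      ← map_add]
    rfl
  map_smul' c f := by
    refine FMat.ext fun o o' => ?_
    rcases o with _ | r
    · simp [entry_untwistFun_none_left]
    rcases o' with _ | s
    · simp [entry_untwistFun_none_right]
    rw [FMat.entry_smul]
    simp only [entry_untwistFun_some]
    rw [RingHom.id_apply, ← α.actFun_smul c (α.coef_mem_D_of_partialSmash f r s), ← map_smul]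
    rfl

theorem entry_untwist_some (f : partialSmash α.grading) (r s : G) :
    (α.untwist f).entry (some r) (some s) = α.actFun r (α.coef (r⁻¹ * s)
      (((f : smash α.grading) : FMat G α.SkewGroupAlgebra).entry r s)) := rfl

theorem entry_untwist_none_left (f : partialSmash α.grading) (o : Option G) :
    (α.untwist f).entry none o = 0 := rfl

theorem entry_untwist_none_right (f : partialSmash α.grading) (o : Option G) :
    (α.untwist f).entry o none = 0 := α.entry_untwistFun_none_right _ o

theorem untwist_injective : Function.Injective α.untwist := by
  intro f g h
  refine Subtype.ext (Subtype.ext (FMat.ext fun r s => ?_))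
  have h1 : (α.untwist f).entry (some r) (some s) = (α.untwist g).entry (some r) (some s) := by
    rw [h]
  rw [entry_untwist_some, entry_untwist_some] at h1
  have h2 := congrArg (α.actFun r⁻¹) h1
  rw [α.actFun_inv_actFun (α.coef_mem_D_of_partialSmash f r s),
    α.actFun_inv_actFun (α.coef_mem_D_of_partialSmash g r s)] at h2
  rw [α.eq_delta_coef ((f : smash α.grading).2 r s),
    α.eq_delta_coef ((g : smash α.grading).2 r s)]
  congr 1
  exact Subtype.ext h2

theorem untwist_mul (f g : partialSmash α.grading) :
    α.untwist (f * g) = α.untwist f * α.untwist g := by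
  classical
  obtain ⟨T, hT⟩ := ((f : smash α.grading) : FMat G α.SkewGroupAlgebra).exists_column_bound
  have hT' : ∀ r s, (α.untwist f).entry r s ≠ 0 → s ∈ T.map Function.Embedding.some := by
    rintro (_ | r) s h
    · exact absurd (α.entry_untwist_none_left f s) h
    rcases s with _ | s
    · exact absurd (α.entry_untwist_none_right f (some r)) h
    · refine Finset.mem_map.2 ⟨s, hT r s fun h0 => h ?_, rfl⟩
      rw [entry_untwist_some, h0, map_zero, actFun_zero]
  refine FMat.ext fun o o' => ?_
  rw [FMat.entry_mul _ _ _ hT', Finset.sum_map]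
  rcases o with _ | r
  · simp [entry_untwist_none_left]
  rcases o' with _ | v
  · simp [entry_untwist_none_right]
  rw [entry_untwist_some]
  change α.actFun r (α.coef (r⁻¹ * v) ((((f : smash α.grading) : FMat G α.SkewGroupAlgebra) *
    ((g : smash α.grading) : FMat G α.SkewGroupAlgebra)).entry r v)) = _
  have key := fun s => α.twist_aux (α.coef_mem_of_partialSmash f r s)
    (α.coef_mem_D_of_partialSmash g s v)
  -- The skew product formula applies after factoring the degree r⁻¹v as (r⁻¹s)(s⁻¹v).
  have e : ∀ s, α.coef (r⁻¹ * v)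
      (((f : smash α.grading) : FMat G α.SkewGroupAlgebra).entry r s *
        ((g : smash α.grading) : FMat G α.SkewGroupAlgebra).entry s v) =
      α.actFun (r⁻¹ * s) (α.actFun (r⁻¹ * s)⁻¹ (α.coef (r⁻¹ * s)
        (((f : smash α.grading) : FMat G α.SkewGroupAlgebra).entry r s)) * α.coef (s⁻¹ * v)
        (((g : smash α.grading) : FMat G α.SkewGroupAlgebra).entry s v)) := by
    intro s
    rw [← α.coef_mul ((f : smash α.grading).2 r s) ((g : smash α.grading).2 s v)]
    congr 2
    group
  rw [FMat.entry_mul _ _ T hT, map_sum, α.actFun_sum]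
  · refine Finset.sum_congr rfl fun s _ => ?_
    rw [e, (key s).2]
    rfl
  · intro s
    rw [e]
    exact (key s).1

theorem mem_canonical_D (t : G) (f : partialSmash α.grading) :
    f ∈ (canonicalPartialAction α.grading α.grading_isPartiallyStrong).D t ↔
      ∀ r s, α.coef (r⁻¹ * s) (((f : smash α.grading) : FMat G α.SkewGroupAlgebra).entry r s) ∈
        α.D r⁻¹ ⬝ₖ (α.D (r⁻¹ * t) ⬝ₖ α.D (r⁻¹ * s)) := by
  have h1 := α.grading_isPartiallyStrong.smash_mul_image t
  have h2 : f ∈ (canonicalPartialAction α.grading α.grading_isPartiallyStrong).D t ↔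
      incl (smash α.grading) f ∈ ((partialSmash α.grading).toSubmodule ⬝ₖ
        (dualAction α.grading).image t (partialSmash α.grading).toSubmodule).map
          (incl (smash α.grading)) := by
    refine ⟨fun h => ⟨_, h, rfl⟩, ?_⟩
    rintro ⟨g, hg, e⟩
    have := incl_injective _ e
    rw [this] at hg
    exact hg
  rw [h2, h1]
  refine forall_congr' fun r => forall_congr' fun s => ?_
  dsimp only
  rw [comp_mulSub_comp₄, mem_liftSub]
  exact ⟨fun h => h.2, fun h => ⟨(f : smash α.grading).2 r s, h⟩⟩

/-- At (r, s), α_r and its inverse exchange D_{r⁻¹} D_{r⁻¹t} D_{r⁻¹s} and D_r D_t D_s. -/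
theorem untwist_mem_matDomain (t : G) (f : partialSmash α.grading) :
    α.untwist f ∈ α.matDomain t ↔
      f ∈ (canonicalPartialAction α.grading α.grading_isPartiallyStrong).D t := by
  rw [mem_canonical_D]
  constructor
  · intro h r s
    have h1 := h (some r) (some s)
    rw [entry_untwist_some] at h1
    simp only [optDeg, Option.getD_some] at h1
    rw [α.D_left_comm] at h1
    have h2 := α.actFun_mem_mulSub₂ (s := r⁻¹) (by rwa [inv_inv])
    rwa [α.actFun_inv_actFun (α.coef_mem_D_of_partialSmash f r s)] at h2
  · rintro h (_ | r) o
    · rw [entry_untwist_none_left]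
      exact Submodule.zero_mem _
    rcases o with _ | s
    · rw [entry_untwist_none_right]
      exact Submodule.zero_mem _
    have h1 := α.actFun_mem_mulSub₂ (h r s)
    rw [mul_inv_cancel_left, mul_inv_cancel_left, α.D_left_comm] at h1
    exact h1

/-- The dual action moves an entry c from (r, s) to (tr, ts) unchanged, so untwisting uses α_{tr} in
place of α_r. The two differ by α_t, as c lies in D_{r⁻¹} D_{(tr)⁻¹} when f is in the domain of γ_t.
-/
theorem untwist_act (t : G) (f g : partialSmash α.grading)
    (hf : f ∈ (canonicalPartialAction α.grading α.grading_isPartiallyStrong).D t⁻¹)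
    (hg : (g : smash α.grading) = (dualAction α.grading).act t f) :
    α.untwist g = α.matAct t (α.untwist f) := by
  refine fmat_ext_optShift t fun o o' => ?_
  rw [entry_matAct_optShift]
  rcases o with _ | r
  · rw [optShift_none, entry_untwist_none_left, entry_untwist_none_left, actFun_zero]
  rcases o' with _ | s
  · rw [optShift_none, entry_untwist_none_right, entry_untwist_none_right, actFun_zero]
  rw [optShift_some, optShift_some, entry_untwist_some, entry_untwist_some, hg]
  have e1 : (((dualAction α.grading).act t f : smash α.grading) :
      FMat G α.SkewGroupAlgebra).entry (t * r) (t * s) =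
      ((f : smash α.grading) : FMat G α.SkewGroupAlgebra).entry r s := by
    change ((f : smash α.grading) : FMat G α.SkewGroupAlgebra).entry (t⁻¹ * (t * r))
      (t⁻¹ * (t * s)) = _
    rw [inv_mul_cancel_left, inv_mul_cancel_left]
  have e2 : (t * r)⁻¹ * (t * s) = r⁻¹ * s := by group
  rw [e1, e2, α.actFun_actFun]
  have h := (α.mem_canonical_D t⁻¹ f).1 hf r s
  rw [mul_inv_rev]
  refine mulSub_mono le_rfl ?_ h
  exact mulSub_le_left (α.isIdeal _)

/-- The entries of the image of the partial smash product. -/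
def smashEntries : Option G → Option G → Submodule k A
  | some r, some s => α.D r ⬝ₖ α.D s
  | _, _ => ⊥

theorem range_untwist : LinearMap.range α.untwist = FMat.entriesIn α.smashEntries := by
  apply le_antisymm
  · rintro _ ⟨f, rfl⟩ (_ | r) o
    · rw [entry_untwist_none_left]
      exact Submodule.zero_mem _
    rcases o with _ | s
    · rw [entry_untwist_none_right]
      exact Submodule.zero_mem _
    have := α.actFun_mem_mulSub (α.coef_mem_of_partialSmash f r s)
    rwa [mul_inv_cancel_left] at this
  · refine FMat.entriesIn_le fun o o' => ?_
    rcases o with _ | r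
    · exact bot_le
    rcases o' with _ | s
    · exact bot_le
    intro a ha
    -- The preimage of a e_{r,s} is α_{r⁻¹}(a) δ_{r⁻¹s} e_{r,s}.
    have ha1 : α.actFun r⁻¹ a ∈ α.D r⁻¹ ⬝ₖ α.D (r⁻¹ * s) :=
      α.actFun_mem_mulSub (by rw [inv_inv]; exact ha)
    have har : a ∈ α.D r := mulSub_le_left (α.isIdeal _) ha
    have hb : α.delta (r⁻¹ * s) ⟨_, mulSub_le_right (α.isIdeal _) ha1⟩ ∈
        α.grading.comp r⁻¹ ⬝ₖ α.grading.comp s := by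
      rw [comp_mulSub_comp, mem_liftSub]
      exact ⟨⟨_, rfl⟩, by rw [coef_delta]; exact ha1⟩
    have hu := FMat.unit_mem_entriesIn (F := fun r s => α.grading.comp r⁻¹ ⬝ₖ α.grading.comp s) hb
    refine ⟨⟨⟨_, fun u v => α.grading.mulSub_le_comp _ _ (hu u v)⟩, hu⟩, ?_⟩
    classical
    refine FMat.ext fun o o' => ?_
    change _ = (FMat.unit (some r) (some s) a).entry o o'
    rw [FMat.entry_unit]
    rcases o with _ | u
    · rw [entry_untwist_none_left]
      simp
    rcases o' with _ | v
    · rw [entry_untwist_none_right]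
      simp
    rw [entry_untwist_some]
    dsimp only
    rw [FMat.entry_unit]
    simp only [Option.some.injEq]
    split_ifs with h
    · obtain ⟨rfl, rfl⟩ := h
      rw [coef_delta, α.actFun_actFun_inv har]
    · rw [map_zero, actFun_zero]

end SmashMatrix

end ProductPartialAction
end PartialActions

namespace PartialActions

/-! ### Morita contexts from Peirce decompositions -/

section MulSub

variable {k E : Type*} [CommRing k] [NonUnitalRing E] [Module k E] [IsScalarTower k E E]
  [SMulCommClass k E E]

theorem bot_mulSub (S : Submodule k E) : (⊥ : Submodule k E) ⬝ₖ S = ⊥ :=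
  Submodule.map₂_bot_left _ _

theorem mulSub_bot (S : Submodule k E) : S ⬝ₖ (⊥ : Submodule k E) = ⊥ :=
  Submodule.map₂_bot_right _ _

/-- Turns the spans in the definition of a Morita equivalence into products of submodules of the
ambient algebra. -/
theorem map_map₂_eq_mulSub {M N P : Type*} [AddCommGroup M] [Module k M] [AddCommGroup N]
    [Module k N] [AddCommGroup P] [Module k P] (f : M →ₗ[k] N →ₗ[k] P) (i : M →ₗ[k] E)
    (j : N →ₗ[k] E) (h : P →ₗ[k] E) (hf : ∀ m n, h (f m n) = i m * j n) (S : Submodule k M)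
    (T : Submodule k N) : (Submodule.map₂ f S T).map h = S.map i ⬝ₖ T.map j := by
  apply le_antisymm
  · rw [Submodule.map_le_iff_le_comap, Submodule.map₂_le]
    intro m hm n hn
    rw [Submodule.mem_comap, hf]
    exact mul_mem_mulSub ⟨m, hm, rfl⟩ ⟨n, hn, rfl⟩
  · rw [mulSub_le]
    rintro _ ⟨m, hm, rfl⟩ _ ⟨n, hn, rfl⟩
    exact ⟨f m n, Submodule.apply_mem_map₂ f hm hn, hf m n⟩

end MulSub

/-- A Peirce decomposition `[A X; Y A']` inside of an algebra `E`. -/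
structure PeirceSystem (k A A' E : Type*) [CommRing k] [NonUnitalRing A] [Module k A]
    [NonUnitalRing A'] [Module k A'] [NonUnitalRing E] [Module k E] where
  /-- the embedding of the upper left corner -/
  ι : A →ₗ[k] E
  /-- the embedding of the lower right corner -/
  ι' : A' →ₗ[k] E
  /-- the upper right corner -/
  X : Submodule k E
  /-- the lower left corner -/
  Y : Submodule k E
  ι_mul : ∀ a b, ι (a * b) = ι a * ι b
  ι'_mul : ∀ a b, ι' (a * b) = ι' a * ι' b
  lX_mem : ∀ a, ∀ x ∈ X, ι a * x ∈ X
  rX_mem : ∀ a, ∀ x ∈ X, x * ι' a ∈ X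
  lY_mem : ∀ a, ∀ y ∈ Y, ι' a * y ∈ Y
  rY_mem : ∀ a, ∀ y ∈ Y, y * ι a ∈ Y
  XY_mem : ∀ x ∈ X, ∀ y ∈ Y, x * y ∈ LinearMap.range ι
  YX_mem : ∀ y ∈ Y, ∀ x ∈ X, y * x ∈ LinearMap.range ι'
  ι_Y : ∀ a, ∀ y ∈ Y, ι a * y = 0
  ι_ι' : ∀ a b, ι a * ι' b = 0
  X_ι : ∀ a, ∀ x ∈ X, x * ι a = 0
  X_X : ∀ x ∈ X, ∀ z ∈ X, x * z = 0
  Y_Y : ∀ y ∈ Y, ∀ z ∈ Y, y * z = 0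
  Y_ι' : ∀ b, ∀ y ∈ Y, y * ι' b = 0
  ι'_ι : ∀ b a, ι' b * ι a = 0
  ι'_X : ∀ b, ∀ x ∈ X, ι' b * x = 0
  indep : ∀ a, ∀ x ∈ X, ∀ y ∈ Y, ∀ b, ι a + x + y + ι' b = 0 → a = 0 ∧ x = 0 ∧ y = 0 ∧ b = 0

namespace PeirceSystem

variable {k A A' E : Type*} [CommRing k] [NonUnitalRing A] [Module k A]
    [NonUnitalRing A'] [Module k A'] [NonUnitalRing E] [Module k E] [IsScalarTower k E E]
    [SMulCommClass k E E] (P : PeirceSystem k A A' E)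

theorem ι_injective : Function.Injective P.ι :=
  (injective_iff_map_eq_zero P.ι).2 fun a ha =>
    (P.indep a 0 (Submodule.zero_mem _) 0 (Submodule.zero_mem _) 0 (by simp [ha])).1

theorem ι'_injective : Function.Injective P.ι' :=
  (injective_iff_map_eq_zero P.ι').2 fun b hb =>
    (P.indep 0 0 (Submodule.zero_mem _) 0 (Submodule.zero_mem _) b (by simp [hb])).2.2.2

/-- The element `a` with `ι a = x y`. -/
noncomputable def pairA (x : P.X) (y : P.Y) : A := (P.XY_mem x x.2 y y.2).choose

/-- The element `a'` with `ι' a' = y x`. -/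
noncomputable def pairA' (y : P.Y) (x : P.X) : A' := (P.YX_mem y y.2 x x.2).choose

theorem ι_pairA (x : P.X) (y : P.Y) : P.ι (P.pairA x y) = x * y :=
  (P.XY_mem x x.2 y y.2).choose_spec

theorem ι'_pairA' (y : P.Y) (x : P.X) : P.ι' (P.pairA' y x) = y * x :=
  (P.YX_mem y y.2 x x.2).choose_spec

/-- The Morita context of a Peirce decomposition. -/
noncomputable def context : MoritaContext k A A' P.X P.Y where
  lX := LinearMap.mk₂ k (fun a x => ⟨P.ι a * x, P.lX_mem a x x.2⟩)
    (fun _ _ _ => Subtype.ext (by simp [add_mul]))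
    (fun _ _ _ => Subtype.ext (by simp [smul_mul_assoc]))
    (fun _ _ _ => Subtype.ext (by simp [mul_add]))
    (fun _ _ _ => Subtype.ext (by simp [mul_smul_comm]))
  rX := LinearMap.mk₂ k (fun x a => ⟨x * P.ι' a, P.rX_mem a x x.2⟩)
    (fun _ _ _ => Subtype.ext (by simp [add_mul]))
    (fun _ _ _ => Subtype.ext (by simp [smul_mul_assoc]))
    (fun _ _ _ => Subtype.ext (by simp [mul_add]))
    (fun _ _ _ => Subtype.ext (by simp [mul_smul_comm]))
  lY := LinearMap.mk₂ k (fun a y => ⟨P.ι' a * y, P.lY_mem a y y.2⟩)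
    (fun _ _ _ => Subtype.ext (by simp [add_mul]))
    (fun _ _ _ => Subtype.ext (by simp [smul_mul_assoc]))
    (fun _ _ _ => Subtype.ext (by simp [mul_add]))
    (fun _ _ _ => Subtype.ext (by simp [mul_smul_comm]))
  rY := LinearMap.mk₂ k (fun y a => ⟨y * P.ι a, P.rY_mem a y y.2⟩)
    (fun _ _ _ => Subtype.ext (by simp [add_mul]))
    (fun _ _ _ => Subtype.ext (by simp [smul_mul_assoc]))
    (fun _ _ _ => Subtype.ext (by simp [mul_add]))
    (fun _ _ _ => Subtype.ext (by simp [mul_smul_comm]))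
  τA := LinearMap.mk₂ k P.pairA
    (fun _ _ _ => P.ι_injective (by simp [ι_pairA, add_mul]))
    (fun _ _ _ => P.ι_injective (by simp [ι_pairA, smul_mul_assoc]))
    (fun _ _ _ => P.ι_injective (by simp [ι_pairA, mul_add]))
    (fun _ _ _ => P.ι_injective (by simp [ι_pairA, mul_smul_comm]))
  τA' := LinearMap.mk₂ k P.pairA'
    (fun _ _ _ => P.ι'_injective (by simp [ι'_pairA', add_mul]))
    (fun _ _ _ => P.ι'_injective (by simp [ι'_pairA', smul_mul_assoc]))
    (fun _ _ _ => P.ι'_injective (by simp [ι'_pairA', mul_add]))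
    (fun _ _ _ => P.ι'_injective (by simp [ι'_pairA', mul_smul_comm]))
  -- All the compatibilities below are associativity in the ambient algebra, read through the
  -- injective corner embeddings.
  lX_mul _ _ _ := Subtype.ext (by simp [ι_mul, mul_assoc])
  rX_mul _ _ _ := Subtype.ext (by simp [ι'_mul, mul_assoc])
  lX_rX _ _ _ := Subtype.ext (by simp [mul_assoc])
  lY_mul _ _ _ := Subtype.ext (by simp [ι'_mul, mul_assoc])
  rY_mul _ _ _ := Subtype.ext (by simp [ι_mul, mul_assoc])
  lY_rY _ _ _ := Subtype.ext (by simp [mul_assoc])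
  τA_left _ _ _ := P.ι_injective (by simp [ι_pairA, ι_mul, mul_assoc])
  τA_right _ _ _ := P.ι_injective (by simp [ι_pairA, ι_mul, mul_assoc])
  τA_balanced _ _ _ := P.ι_injective (by simp [ι_pairA, mul_assoc])
  τA'_left _ _ _ := P.ι'_injective (by simp [ι'_pairA', ι'_mul, mul_assoc])
  τA'_right _ _ _ := P.ι'_injective (by simp [ι'_pairA', ι'_mul, mul_assoc])
  τA'_balanced _ _ _ := P.ι'_injective (by simp [ι'_pairA', mul_assoc])
  assoc_X _ _ _ := Subtype.ext (by simp [ι_pairA, ι'_pairA', mul_assoc])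
  assoc_Y _ _ _ := Subtype.ext (by simp [ι_pairA, ι'_pairA', mul_assoc])

theorem ι_τA (x : P.X) (y : P.Y) : P.ι (P.context.τA x y) = x * y := P.ι_pairA x y

theorem ι'_τA' (y : P.Y) (x : P.X) : P.ι' (P.context.τA' y x) = y * x := P.ι'_pairA' y x

theorem context_isEquivalence (h₁ : LinearMap.range P.ι ⬝ₖ P.X = P.X)
    (h₂ : P.X ⬝ₖ LinearMap.range P.ι' = P.X) (h₃ : LinearMap.range P.ι' ⬝ₖ P.Y = P.Y)
    (h₄ : P.Y ⬝ₖ LinearMap.range P.ι = P.Y) (h₅ : P.X ⬝ₖ P.Y = LinearMap.range P.ι)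
    (h₆ : P.Y ⬝ₖ P.X = LinearMap.range P.ι') : P.context.IsEquivalence where
  lX_unital := Submodule.map_injective_of_injective P.X.injective_subtype (by
    rw [map_map₂_eq_mulSub _ P.ι P.X.subtype _ fun _ _ => rfl]
    simpa using h₁)
  rX_unital := Submodule.map_injective_of_injective P.X.injective_subtype (by
    rw [map_map₂_eq_mulSub _ P.X.subtype P.ι' _ fun _ _ => rfl]
    simpa using h₂)
  lY_unital := Submodule.map_injective_of_injective P.Y.injective_subtype (by
    rw [map_map₂_eq_mulSub _ P.ι' P.Y.subtype _ fun _ _ => rfl]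
    simpa using h₃)
  rY_unital := Submodule.map_injective_of_injective P.Y.injective_subtype (by
    rw [map_map₂_eq_mulSub _ P.Y.subtype P.ι _ fun _ _ => rfl]
    simpa using h₄)
  τA_surjective := Submodule.map_injective_of_injective P.ι_injective (by
    rw [map_map₂_eq_mulSub _ P.X.subtype P.Y.subtype _ P.ι_τA]
    simpa using h₅)
  τA'_surjective := Submodule.map_injective_of_injective P.ι'_injective (by
    rw [map_map₂_eq_mulSub _ P.Y.subtype P.X.subtype _ P.ι'_τA']
    simpa using h₆)

theorem map_ι'_sandwich (S : Submodule k A) :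
    (Submodule.map₂ P.context.τA' (Submodule.map₂ P.context.rY ⊤ S) ⊤).map P.ι' =
      P.Y ⬝ₖ S.map P.ι ⬝ₖ P.X := by
  rw [map_map₂_eq_mulSub _ P.Y.subtype P.X.subtype _ P.ι'_τA',
    map_map₂_eq_mulSub _ P.Y.subtype P.ι _ fun _ _ => rfl, Submodule.map_top, Submodule.map_top,
    Submodule.range_subtype, Submodule.range_subtype]

/-- The context algebra, embedded in `E`. -/
noncomputable def embed : P.context.ContextAlgebra →ₗ[k] E where
  toFun c := P.ι c.1.1 + c.1.2 + c.2.1 + P.ι' c.2.2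
  map_add' c d := by
    obtain ⟨a₁, x₁, y₁, b₁, rfl⟩ := P.context.exists_mat c
    obtain ⟨a₂, x₂, y₂, b₂, rfl⟩ := P.context.exists_mat d
    rw [MoritaContext.mat_add_mat]
    simp only [MoritaContext.mat, map_add, Submodule.coe_add]
    abel
  map_smul' r c := by
    obtain ⟨a₁, x₁, y₁, b₁, rfl⟩ := P.context.exists_mat c
    rw [MoritaContext.smul_mat]
    simp only [MoritaContext.mat, map_smul, Submodule.coe_smul, smul_add, RingHom.id_apply]

theorem embed_mat (a : A) (x : P.X) (y : P.Y) (b : A') :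
    P.embed (P.context.mat a x y b) = P.ι a + x + y + P.ι' b := rfl

theorem embed_inA (a : A) : P.embed (P.context.inA a) = P.ι a := by
  refine (P.embed_mat a 0 0 0).trans ?_
  simp

theorem embed_inA' (b : A') : P.embed (P.context.inA' b) = P.ι' b := by
  refine (P.embed_mat 0 0 0 b).trans ?_
  simp

theorem embed_mul (c d : P.context.ContextAlgebra) : P.embed (c * d) = P.embed c * P.embed d := by
  obtain ⟨a₁, x₁, y₁, b₁, rfl⟩ := P.context.exists_mat c
  obtain ⟨a₂, x₂, y₂, b₂, rfl⟩ := P.context.exists_mat d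
  rw [MoritaContext.mat_mul_mat, embed_mat, embed_mat, embed_mat]
  have e₁ : ((P.context.lX a₁ x₂ : P.X) : E) = P.ι a₁ * x₂ := rfl
  have e₂ : ((P.context.rX x₁ b₂ : P.X) : E) = x₁ * P.ι' b₂ := rfl
  have e₃ : ((P.context.rY y₁ a₂ : P.Y) : E) = y₁ * P.ι a₂ := rfl
  have e₄ : ((P.context.lY b₁ y₂ : P.Y) : E) = P.ι' b₁ * y₂ := rfl
  -- Of the sixteen products of corners, the eight with mismatched inner indices vanish.
  simp only [map_add, Submodule.coe_add, ι_τA, ι'_τA', ι_mul, ι'_mul, e₁, e₂, e₃, e₄, add_mul,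
    mul_add, P.ι_Y _ _ y₂.2, P.ι_ι', P.X_ι _ _ x₁.2, P.X_X _ x₁.2 _ x₂.2, P.Y_Y _ y₁.2 _ y₂.2,
    P.Y_ι' _ _ y₁.2, P.ι'_ι, P.ι'_X _ _ x₂.2]
  abel

theorem embed_injective : Function.Injective P.embed := by
  refine (injective_iff_map_eq_zero P.embed).2 fun c hc => ?_
  obtain ⟨a, x, y, b, rfl⟩ := P.context.exists_mat c
  rw [embed_mat] at hc
  obtain ⟨ha, hx, hy, hb⟩ := P.indep a x x.2 y y.2 b hc
  rw [← MoritaContext.mat_zero]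
  exact P.context.mat_congr ha (Subtype.ext hx) (Subtype.ext hy) hb

theorem range_embed : LinearMap.range P.embed =
    LinearMap.range P.ι ⊔ P.X ⊔ P.Y ⊔ LinearMap.range P.ι' := by
  apply le_antisymm
  · rintro _ ⟨c, rfl⟩
    exact Submodule.add_mem_sup (Submodule.add_mem_sup (Submodule.add_mem_sup ⟨_, rfl⟩
      (Subtype.property _)) (Subtype.property _)) ⟨_, rfl⟩
  · refine sup_le (sup_le (sup_le ?_ ?_) ?_) ?_
    · rintro _ ⟨a, rfl⟩
      exact ⟨_, P.embed_inA a⟩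
    · intro x hx
      exact ⟨P.context.mat 0 ⟨x, hx⟩ 0 0, by rw [embed_mat]; simp⟩
    · intro y hy
      exact ⟨P.context.mat 0 0 ⟨y, hy⟩ 0, by rw [embed_mat]; simp⟩
    · rintro _ ⟨b, rfl⟩
      exact ⟨_, P.embed_inA' b⟩

end PeirceSystem

end PartialActions

namespace PartialActions

theorem FMat.mul_eq_zero_of_entriesIn {k H B : Type*} [CommRing k] [NonUnitalRing B] [Module k B]
    [IsScalarTower k B B] [SMulCommClass k B B] {F F' : H → H → Submodule k B}
    (h : ∀ r s v, F r s ⬝ₖ F' s v = ⊥) {f g : FMat H B} (hf : f ∈ entriesIn F)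
    (hg : g ∈ entriesIn F') : f * g = 0 := by
  refine FMat.ext fun r v => (Submodule.mem_bot k).1 (entry_mul_mem f g r v _ fun s => ?_)
  rw [← h r s v]
  exact mul_mem_mulSub (hf r s) (hg s v)

namespace ProductPartialAction

/-! ### Morita equivalence of α and the canonical partial action -/

section Canonical

variable {k G A : Type*} [CommRing k] [Group G] [NonUnitalRing A]
    [Module k A] [IsScalarTower k A A] [SMulCommClass k A A] (α : ProductPartialAction k G A)

/-- The entries of the upper left corner. -/
def cornerEntries (S : Submodule k A) : Option G → Option G → Submodule k A
  | none, none => S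
  | _, _ => ⊥

/-- The entries of the upper right corner. -/
def rowEntries : Option G → Option G → Submodule k A
  | none, some s => α.D s
  | _, _ => ⊥

/-- The entries of the lower left corner. -/
def colEntries : Option G → Option G → Submodule k A
  | some r, none => α.D r
  | _, _ => ⊥

theorem map_unitHom_none (S : Submodule k A) :
    S.map (FMat.unitHom k (none : Option G) none) = FMat.entriesIn (cornerEntries S) := by
  apply le_antisymm
  · rintro _ ⟨a, ha, rfl⟩
    exact FMat.unit_mem_entriesIn' ha
  · refine FMat.entriesIn_le ?_
    rintro (_ | r) (_ | s)
    · exact fun a ha => ⟨a, ha, rfl⟩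
    all_goals exact bot_le

theorem range_unitHom_none :
    LinearMap.range (FMat.unitHom (B := A) k (none : Option G) none) =
      FMat.entriesIn (cornerEntries (α.D 1)) := by
  rw [← map_unitHom_none, α.D_one, Submodule.map_top]

theorem corner_mul_row : FMat.entriesIn (cornerEntries (α.D 1)) ⬝ₖ FMat.entriesIn α.rowEntries =
    FMat.entriesIn α.rowEntries := by
  rw [FMat.entriesIn_mul_entriesIn]
  congr 1
  funext o o'
  rw [iSup_option]
  rcases o with _ | r <;> rcases o' with _ | s <;>
    simp [cornerEntries, rowEntries, bot_mulSub, mulSub_bot, D_one_mul]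

theorem row_mul_smash : FMat.entriesIn α.rowEntries ⬝ₖ FMat.entriesIn α.smashEntries =
    FMat.entriesIn α.rowEntries := by
  rw [FMat.entriesIn_mul_entriesIn]
  congr 1
  funext o o'
  rw [iSup_option]
  rcases o with _ | r <;> rcases o' with _ | s <;>
    simp [smashEntries, rowEntries, bot_mulSub, mulSub_bot, D_left_idem]
  -- The entry is ∑_r D_r D_s; every term lies in D_s and the term r = s equals it.
  exact le_antisymm (iSup_le fun r => mulSub_le_right (α.isIdeal s))
    ((α.D_idem s).ge.trans (le_iSup (fun r => α.D r ⬝ₖ α.D s) s))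

theorem smash_mul_col : FMat.entriesIn α.smashEntries ⬝ₖ FMat.entriesIn α.colEntries =
    FMat.entriesIn α.colEntries := by
  rw [FMat.entriesIn_mul_entriesIn]
  congr 1
  funext o o'
  rw [iSup_option]
  rcases o with _ | r <;> rcases o' with _ | s <;>
    simp [smashEntries, colEntries, bot_mulSub, mulSub_bot, mulSub_assoc, D_idem]
  exact le_antisymm (iSup_le fun s => mulSub_le_left (α.isIdeal r))
    ((α.D_idem r).ge.trans (le_iSup (fun s => α.D r ⬝ₖ α.D s) r))

theorem col_mul_corner (S : Submodule k A) :
    FMat.entriesIn α.colEntries ⬝ₖ FMat.entriesIn (cornerEntries S) =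
      FMat.entriesIn (Option.elim · (fun _ => ⊥) fun r => (Option.elim · (α.D r ⬝ₖ S) fun _ => ⊥)) := by
  rw [FMat.entriesIn_mul_entriesIn]
  congr 1
  funext o o'
  rw [iSup_option]
  rcases o with _ | r <;> rcases o' with _ | s <;>
    simp [cornerEntries, colEntries, bot_mulSub, mulSub_bot]

theorem col_mul_corner_one :
    FMat.entriesIn α.colEntries ⬝ₖ FMat.entriesIn (cornerEntries (α.D 1)) =
      FMat.entriesIn α.colEntries := by
  rw [col_mul_corner]
  congr 1
  funext o o'
  rcases o with _ | r <;> rcases o' with _ | s <;> simp [colEntries, D_mul_one]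

theorem row_mul_col : FMat.entriesIn α.rowEntries ⬝ₖ FMat.entriesIn α.colEntries =
    FMat.entriesIn (cornerEntries (α.D 1)) := by
  rw [FMat.entriesIn_mul_entriesIn]
  congr 1
  funext o o'
  rw [iSup_option]
  rcases o with _ | r <;> rcases o' with _ | s <;>
    simp [cornerEntries, rowEntries, colEntries, bot_mulSub, mulSub_bot, D_idem]
  -- X Y is ∑_r D_r, and the term r = 1 is already all of `A`.
  exact le_antisymm (by rw [α.D_one]; exact le_top) (le_iSup α.D 1)

/-- Serves twice: S = D_1 gives Y X, and S = D_t gives Y D_t X. -/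
theorem col_mul_corner_mul_row (S : Submodule k A) :
    FMat.entriesIn α.colEntries ⬝ₖ FMat.entriesIn (cornerEntries S) ⬝ₖ
      FMat.entriesIn α.rowEntries =
      FMat.entriesIn (Option.elim · (fun _ => ⊥) fun r =>
        (Option.elim · ⊥ fun s => α.D r ⬝ₖ S ⬝ₖ α.D s)) := by
  rw [col_mul_corner, FMat.entriesIn_mul_entriesIn]
  congr 1
  funext o o'
  rw [iSup_option]
  rcases o with _ | r <;> rcases o' with _ | s <;>
    simp [rowEntries, bot_mulSub, mulSub_bot]

theorem col_mul_row : FMat.entriesIn α.colEntries ⬝ₖ FMat.entriesIn α.rowEntries =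
    FMat.entriesIn α.smashEntries := by
  rw [← col_mul_corner_one, col_mul_corner_mul_row]
  congr 1
  funext o o'
  rcases o with _ | r <;> rcases o' with _ | s <;> simp [smashEntries, D_mul_one]

/-- The Peirce decomposition whose corners are `A` and the partial smash product. -/
noncomputable def smashSystem :
    PeirceSystem k A (partialSmash α.grading) (FMat (Option G) A) :=
  have hA : ∀ a, FMat.unitHom k none none a ∈ FMat.entriesIn (cornerEntries (G := G) (α.D 1)) :=
    fun a => α.range_unitHom_none ▸ ⟨a, rfl⟩
  have hI : ∀ b, α.untwist b ∈ FMat.entriesIn α.smashEntries := fun b =>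
    α.range_untwist ▸ ⟨b, rfl⟩
  { ι := FMat.unitHom k none none
    ι' := α.untwist
    X := FMat.entriesIn α.rowEntries
    Y := FMat.entriesIn α.colEntries
    ι_mul := fun a b => (FMat.unit_mul_unit_same none none none a b).symm
    ι'_mul := α.untwist_mul
    lX_mem := fun a x hx => α.corner_mul_row.le (mul_mem_mulSub (hA a) hx)
    rX_mem := fun b x hx => α.row_mul_smash.le (mul_mem_mulSub hx (hI b))
    lY_mem := fun b y hy => α.smash_mul_col.le (mul_mem_mulSub (hI b) hy)
    rY_mem := fun a y hy => α.col_mul_corner_one.le (mul_mem_mulSub hy (hA a))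
    XY_mem := fun x hx y hy => by
      rw [α.range_unitHom_none]
      exact α.row_mul_col.le (mul_mem_mulSub hx hy)
    YX_mem := fun y hy x hx => by
      rw [α.range_untwist]
      exact α.col_mul_row.le (mul_mem_mulSub hy hx)
    ι_Y := fun a y hy => FMat.mul_eq_zero_of_entriesIn (by
      rintro (_ | r) (_ | s) (_ | v) <;> simp [cornerEntries, colEntries, bot_mulSub, mulSub_bot])
      (hA a) hy
    ι_ι' := fun a b => FMat.mul_eq_zero_of_entriesIn (by
      rintro (_ | r) (_ | s) (_ | v) <;> simp [cornerEntries, smashEntries, bot_mulSub, mulSub_bot])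
      (hA a) (hI b)
    X_ι := fun a x hx => FMat.mul_eq_zero_of_entriesIn (by
      rintro (_ | r) (_ | s) (_ | v) <;> simp [cornerEntries, rowEntries, bot_mulSub, mulSub_bot])
      hx (hA a)
    X_X := fun x hx z hz => FMat.mul_eq_zero_of_entriesIn (by
      rintro (_ | r) (_ | s) (_ | v) <;> simp [rowEntries, bot_mulSub, mulSub_bot])
      hx hz
    Y_Y := fun y hy z hz => FMat.mul_eq_zero_of_entriesIn (by
      rintro (_ | r) (_ | s) (_ | v) <;> simp [colEntries, bot_mulSub, mulSub_bot])
      hy hz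
    Y_ι' := fun b y hy => FMat.mul_eq_zero_of_entriesIn (by
      rintro (_ | r) (_ | s) (_ | v) <;> simp [smashEntries, colEntries, bot_mulSub, mulSub_bot])
      hy (hI b)
    ι'_ι := fun b a => FMat.mul_eq_zero_of_entriesIn (by
      rintro (_ | r) (_ | s) (_ | v) <;> simp [smashEntries, cornerEntries, bot_mulSub, mulSub_bot])
      (hI b) (hA a)
    ι'_X := fun b x hx => FMat.mul_eq_zero_of_entriesIn (by
      rintro (_ | r) (_ | s) (_ | v) <;> simp [smashEntries, rowEntries, bot_mulSub, mulSub_bot])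
      (hI b) hx
    indep := fun a x hx y hy b h => by
      classical
      -- The four corners occupy disjoint blocks of positions, so at each position at most one
      -- summand survives.
      have hent : ∀ o o', (FMat.unitHom k none none a : FMat (Option G) A).entry o o' +
          x.entry o o' + y.entry o o' + (α.untwist b).entry o o' = 0 := fun o o' => by
        rw [← FMat.entry_add, ← FMat.entry_add, ← FMat.entry_add, h, FMat.entry_zero]
      have hA' := hA a
      have hI' := hI b
      have z : ∀ {u : A}, u ∈ (⊥ : Submodule k A) → u = 0 := fun h => (Submodule.mem_bot k).1 h
      have h₁ : FMat.unitHom k (none : Option G) none a = 0 := FMat.ext fun o o' => by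
        rcases o with _ | r <;> rcases o' with _ | s
        · have := hent none none
          rwa [z (hx none none), z (hy none none), z (hI' none none), add_zero, add_zero,
            add_zero] at this
        · exact z (hA' none (some s))
        · exact z (hA' (some r) none)
        · exact z (hA' (some r) (some s))
      have h₂ : x = 0 := FMat.ext fun o o' => by
        rcases o with _ | r <;> rcases o' with _ | s
        · exact z (hx none none)
        · have := hent none (some s)
          rwa [z (hA' none (some s)), z (hy none (some s)), z (hI' none (some s)), zero_add,
            add_zero, add_zero] at this
        · exact z (hx (some r) none)
        · exact z (hx (some r) (some s))
      have h₃ : y = 0 := FMat.ext fun o o' => by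
        rcases o with _ | r <;> rcases o' with _ | s
        · exact z (hy none none)
        · exact z (hy none (some s))
        · have := hent (some r) none
          rwa [z (hA' (some r) none), z (hx (some r) none), z (hI' (some r) none), zero_add,
            zero_add, add_zero] at this
        · exact z (hy (some r) (some s))
      rw [h₁, h₂, h₃, zero_add, zero_add, zero_add] at h
      refine ⟨?_, h₂, h₃, α.untwist_injective (h.trans (map_zero _).symm)⟩
      have h₄ : (FMat.unit (none : Option G) none a).entry none none = 0 :=
        congrArg (fun f => FMat.entry f none none) h₁
      rwa [FMat.entry_unit, if_pos ⟨rfl, rfl⟩] at h₄ }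

theorem smashSystem_isEquivalence : α.smashSystem.context.IsEquivalence := by
  have hA : LinearMap.range α.smashSystem.ι = FMat.entriesIn (cornerEntries (α.D 1)) :=
    α.range_unitHom_none
  have hI : LinearMap.range α.smashSystem.ι' = FMat.entriesIn α.smashEntries := α.range_untwist
  apply PeirceSystem.context_isEquivalence <;> simp only [hA, hI]
  exacts [α.corner_mul_row, α.row_mul_smash, α.smash_mul_col, α.col_mul_corner_one, α.row_mul_col,
    α.col_mul_row]

/-- The four blocks, according to which indices equal ∗, are the four corners: D_{deg o} D_{deg o'}
is D_1, D_s, D_r or D_r D_s. Thus the matrix partial action lives exactly on the context algebra. -/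
theorem matDomain_one_eq_range : α.matDomain 1 = LinearMap.range α.smashSystem.embed := by
  have hA : LinearMap.range α.smashSystem.ι = FMat.entriesIn (cornerEntries (α.D 1)) :=
    α.range_unitHom_none
  have hI : LinearMap.range α.smashSystem.ι' = FMat.entriesIn α.smashEntries := α.range_untwist
  have hX : α.smashSystem.X = FMat.entriesIn α.rowEntries := rfl
  have hY : α.smashSystem.Y = FMat.entriesIn α.colEntries := rfl
  rw [PeirceSystem.range_embed, hA, hI, hX, hY, matDomain]
  apply le_antisymm
  · refine FMat.entriesIn_le ?_
    rintro (_ | r) (_ | s) a ha <;> rw [D_one_mul_mul] at ha <;>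
      simp only [optDeg, Option.getD_some, Option.getD_none, D_one_mul, D_mul_one] at ha
    · exact Submodule.mem_sup_left (Submodule.mem_sup_left (Submodule.mem_sup_left
        (FMat.unit_mem_entriesIn' ha)))
    · exact Submodule.mem_sup_left (Submodule.mem_sup_left (Submodule.mem_sup_right
        (FMat.unit_mem_entriesIn' ha)))
    · exact Submodule.mem_sup_left (Submodule.mem_sup_right (FMat.unit_mem_entriesIn' ha))
    · exact Submodule.mem_sup_right (FMat.unit_mem_entriesIn' ha)
  · refine sup_le (sup_le (sup_le ?_ ?_) ?_) ?_ <;> refine FMat.entriesIn_mono ?_ <;>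
      rintro (_ | r) (_ | s) <;> rw [D_one_mul_mul] <;>
      simp [cornerEntries, rowEntries, colEntries, smashEntries, optDeg, D_one_mul, D_mul_one]

theorem unit_mem_matDomain (t : G) (a : A) :
    FMat.unit none none a ∈ α.matDomain t ↔ a ∈ α.D t := by
  have e : α.D t ⬝ₖ (α.D (optDeg (none : Option G)) ⬝ₖ α.D (optDeg (none : Option G))) =
      α.D t := by
    simp only [optDeg, Option.getD_none, D_mul_one]
  classical
  constructor
  · intro h
    have := h none none
    rw [FMat.entry_unit, if_pos ⟨rfl, rfl⟩] at this
    exact e.le this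
  · intro h
    exact FMat.unit_mem_entriesIn' (by rwa [e])

/-- As ∗ is fixed by translation, θ_t is α_t on the corner `A`. -/
theorem matAct_unit (t : G) (a : A) :
    α.matAct t (FMat.unit none none a) = FMat.unit none none (α.actFun t a) := by
  classical
  refine fmat_ext_optShift t fun o o' => ?_
  rw [entry_matAct_optShift, FMat.entry_unit, FMat.entry_unit]
  rcases o with _ | r <;> rcases o' with _ | s <;>
    simp [optShift_none, optShift_some, actFun_zero]

theorem moritaEquivalent_canonical : α.MoritaEquivalent
    (canonicalPartialAction α.grading α.grading_isPartiallyStrong) := by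
  refine ⟨_, _, _, _, _, _, α.smashSystem.context, α.matrixPartialAction.pullback
    α.smashSystem.embed α.smashSystem.embed_injective α.smashSystem.embed_mul
    α.matDomain_one_eq_range, α.smashSystem_isEquivalence, fun t => ?_, ⟨fun t => ?_, ?_⟩,
    ⟨fun t => ?_, ?_⟩⟩
  · refine Submodule.map_injective_of_injective α.untwist_injective ?_
    refine (α.smashSystem.map_ι'_sandwich (α.D t)).trans ?_
    refine (congrArg (fun S => FMat.entriesIn α.colEntries ⬝ₖ S ⬝ₖ FMat.entriesIn α.rowEntries)
      (map_unitHom_none (α.D t))).trans ?_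
    rw [col_mul_corner_mul_row]
    have hD : (canonicalPartialAction α.grading α.grading_isPartiallyStrong).D t =
        (α.matDomain t).comap α.untwist :=
      Submodule.ext fun f => (α.untwist_mem_matDomain t f).symm
    change _ = Submodule.map α.untwist _
    -- The domain of γ_t becomes the part of the matrix domain supported on G × G. Its entries D_t
    -- D_r D_s agree with D_r D_t D_s, the entries of Y D_t X, by commutativity.
    rw [hD, Submodule.map_comap_eq, range_untwist]
    ext f
    rw [Submodule.mem_inf]
    constructor
    · intro hf
      constructor
      · rintro (_ | r) (_ | s)
        · exact hf none none
        · exact hf none (some s)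
        · exact hf (some r) none
        · have := hf (some r) (some s)
          simp only [Option.elim] at this
          exact mulSub_mono (mulSub_le_left (α.isIdeal r)) le_rfl this
      · rintro (_ | r) (_ | s)
        · exact bot_le (a := α.D t ⬝ₖ _) (hf none none)
        · exact bot_le (a := α.D t ⬝ₖ _) (hf none (some s))
        · exact bot_le (a := α.D t ⬝ₖ _) (hf (some r) none)
        · have := hf (some r) (some s)
          simp only [Option.elim] at this
          rwa [α.D_comm r, mulSub_assoc] at this
    · rintro ⟨h₁, h₂⟩ (_ | r) (_ | s)
      · exact h₁ none none
      · exact h₁ none (some s)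
      · exact h₁ (some r) none
      · have := h₂ (some r) (some s)
        simp only [optDeg, Option.getD_some] at this
        simp only [Option.elim]
        rwa [α.D_comm r, mulSub_assoc]
  · ext a
    change α.smashSystem.embed (α.smashSystem.context.inA a) ∈ α.matDomain t ↔ _
    rw [PeirceSystem.embed_inA]
    exact α.unit_mem_matDomain t a
  · intro t a c hc
    apply α.smashSystem.embed_injective
    refine (α.matrixPartialAction.map_pullbackAct _ α.smashSystem.embed_injective
      α.matDomain_one_eq_range t c).trans ?_
    rw [hc, PeirceSystem.embed_inA, PeirceSystem.embed_inA]
    refine (α.matAct_unit t a).trans ?_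
    rw [α.actFun_of_mem a.2]
    rfl
  · ext f
    change α.smashSystem.embed (α.smashSystem.context.inA' f) ∈ α.matDomain t ↔ _
    rw [PeirceSystem.embed_inA']
    exact α.untwist_mem_matDomain t f
  · intro t f c hc
    apply α.smashSystem.embed_injective
    refine (α.matrixPartialAction.map_pullbackAct _ α.smashSystem.embed_injective
      α.matDomain_one_eq_range t c).trans ?_
    rw [hc, PeirceSystem.embed_inA', PeirceSystem.embed_inA']
    exact (α.untwist_act t f _ f.2 rfl).symm

end Canonical

theorem Isomorphic.refl {k G A : Type*} [CommRing k] [Group G] [NonUnitalRing A] [Module k A]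
    [IsScalarTower k A A] [SMulCommClass k A A] (α : ProductPartialAction k G A) :
    α.Isomorphic α := by
  refine ⟨NonUnitalAlgHom.id k A, Function.bijective_id, fun t => Submodule.map_id _, ?_⟩
  intro t a b h
  have : b = a := Subtype.ext h
  rw [this]
  rfl

end ProductPartialAction

/-! ### The dual action as minimal globalization -/

section Globalization

variable {k G B : Type*} [CommRing k] [Group G] [NonUnitalRing B]
    [Module k B] [IsScalarTower k B B] [SMulCommClass k B B] {𝓑 : Grading k G B}

theorem Grading.IsPartiallyStrong.iSup_image_partialSmash (h : 𝓑.IsPartiallyStrong) :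
    ⨆ t, (dualAction 𝓑).image t (partialSmash 𝓑).toSubmodule = ⊤ := by
  refine Submodule.map_injective_of_injective (incl_injective (smash 𝓑)) ?_
  apply le_antisymm (Submodule.map_mono le_top)
  have e : Submodule.map (incl (smash 𝓑)) ⊤ ≤ FMat.entriesIn fun r s => 𝓑.comp (r⁻¹ * s) := by
    rintro _ ⟨f, -, rfl⟩
    exact f.2
  refine e.trans (FMat.entriesIn_le fun r s b hb => ?_)
  -- The translate by t = r suffices for a matrix unit in row r: its (r, s) entries are B_1 B_{r⁻¹s}
  -- = B_{r⁻¹s}.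
  refine Submodule.map_mono (le_iSup _ r) ?_
  rw [map_incl_image_partialSmash]
  refine FMat.unit_mem_entriesIn ?_
  rwa [inv_mul_cancel, inv_one, h.one_mul]

theorem isMinimalGlobalization_dualAction (h : 𝓑.IsPartiallyStrong) :
    IsMinimalGlobalization (dualAction 𝓑) (canonicalPartialAction 𝓑 h) :=
  ⟨partialSmash 𝓑, partialSmash_isIdeal 𝓑, h.smash_idem, h.smash_comm,
    ProductPartialAction.Isomorphic.refl _, h.iSup_image_partialSmash⟩

end Globalization

end PartialActions

/-- Let `α` be a product partial action of `G` on `A`, and let `B = A ⋊_α G`. Then `α` is Morita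
equivalent to the canonical partial action `γ^B` on the partial smash product `I^B`, and the dual
action `β^B` on `B # G` is a Morita enveloping action of `α`. -/
theorem mainTheorem3 {k G A : Type*} [CommRing k] [Group G] [NonUnitalRing A] [Module k A]
    [IsScalarTower k A A] [SMulCommClass k A A]
    (α : PartialActions.ProductPartialAction k G A) :
    α.MoritaEquivalent
        (PartialActions.canonicalPartialAction α.grading α.grading_isPartiallyStrong) ∧
      PartialActions.IsMoritaEnvelopingAction (PartialActions.dualAction α.grading) α :=
  ⟨α.moritaEquivalent_canonical, _, _, _, _, _, _, α.moritaEquivalent_canonical,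
    PartialActions.isMinimalGlobalization_dualAction α.grading_isPartiallyStrong⟩
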